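/- Let $r\ge 3$. Number the nodes of the Dynkin diagram $D_r$ by $1,\dots,r$, so that $1,\dots,r-2$ form a chain and $r-1$, $r$ (the spinor nodes) are both joined to $r-2$. Let $Y=A_{\mathbb N}$ (nodes $m=1,2,3,\dots$) or $Y=A_n$ with $n\ge1$ (nodes $m=1,\dots,n$). The Hirota equations of type $(D_r,Y)$ for complex numbers $z_{im}$ are $$z_{im}^2=z_{i,m-1}\,z_{i,m+1}+\prod_{j\sim i}z_{jm}$$ for all nodes $i$ of $D_r$ and $m$ of $Y$, where $j\sim i$ means that $j$ and $i$ are joined in $D_r$, and $z_{i0}=1$ and, for $Y=A_n$, $z_{i,n+1}=1$. Let $S(D_r,Y)$ be the Zariski closure, in the space of all families $(z_{im})$, of the set of solutions with all $z_{im}\neq0$. For complex numbers $x_1,\dots,x_r$ put $x_0=1$ and define, for indices in $\mathbb Z$, $$X_{2j+1}=x_j=-X_{4r-3-2j}\ (0\le j\le r-2),\qquad X_{2r-2}=-x_{r-1},\quad X_{2r}=-x_r,\qquad X_j=0\text{ otherwise},$$ $$Y_2=-Y_6=1,\quad Y_3=x_r,\quad Y_5=x_{r-1},\qquad Y_j=0\text{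 otherwise}.$$ For sequences $P=(P_j)_{j\in\mathbb Z}$ and $Q=(Q_j)_{j\in\mathbb Z}$ let $T_N(P,Q)$ be the $N\times N$ matrix with entries $P_{k-j+1}$ in the odd rows $j$ and $Q_{k-j+2}$ in the even rows $j$ ($1\le j,k\le N$); thus $T_{jk}=T_{j+2,k+2}$, the first row is $P_1,P_2,\dots$ and the second row is $Q_1,Q_2,\dots$. For $m\ge1$ put $$T^i_m=T_{2m-1}\big((X_{2i+j})_j,(Y_j)_j\big)\ (1\le i\le r-2),$$ $$T^{r-1}_m=T_{2m}\big((Y_{3+j})_j,(X_{2r-3+j})_j\big),\qquad T^r_m=T_{2m}\big((X_{2r-2+j})_j,(Y_{2+j})_j\big).$$ Then $T^{r-1}_m$ and $T^r_m$ are antisymmetric. Write $\mathrm{Pf}\,A=\frac1{2^m m!}\sum_{\sigma\in S_{2m}}\mathrm{sgn}(\sigma)\prod_{l=1}^m A_{\sigma(2l-1),\sigma(2l)}$ for the Pfaffian of a $2m\times2m$ matrix, and consider the formulas $$z_{im}=\det T^i_m\ (1\le i\le r-2),\qquad z_{r-1,m}=\mathrm{Pf}\,T^{r-1}_m,\qquad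 z_{rm}=(-1)^m\,\mathrm{Pf}\,T^r_m.\qquad(*)$$ (a) For every $(x_1,\dots,x_r)\in\mathbb C^r$, the numbers $z_{im}$ ($m\ge1$) defined by $(*)$ satisfy the Hirota equations of type $(D_r,A_{\mathbb N})$, form a point of $S(D_r,A_{\mathbb N})$, and have $z_{i1}=x_i$ for all $i$. (b) Every point $z$ of $S(D_r,A_{\mathbb N})$, and every point $z$ of $S(D_r,A_n)$, $n\ge1$, satisfies $(*)$ with $x_i=z_{i1}$, for all nodes $i$ of $D_r$ and all nodes $m$ of $A_{\mathbb N}$ or $A_n$. -/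

import Mathlib

open scoped Matrix

noncomputable section

/-- The Cartan matrix of the half-infinite diagram `A_ℕ`; its nodes `1, 2, 3, …` are numbered
`0, 1, 2, …` here. -/
def cartanAInf : Matrix ℕ ℕ ℤ :=
  Matrix.of fun i j => if i = j then 2 else if i + 1 = j ∨ j + 1 = i then -1 else 0

/-- The solutions `z = (z_{ab})` of the discrete Hirota equations
`z ^ ((2 - C(X)) ⊗ I) + z ^ (I ⊗ (2 - C(Y))) = z ^ 2`, where `CX`, `CY` are simply laced Cartan
matrices, so that `2 - C` is the adjacency matrix of the Dynkin diagram and all exponents are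
non-negative. -/
def hirotaSolutions {κ ι : Type} [DecidableEq κ] [DecidableEq ι]
    (CX : Matrix κ κ ℤ) (CY : Matrix ι ι ℤ) : Set (κ × ι → ℂ) :=
  {z | ∀ a b,
    (∏ᶠ a', z (a', b) ^ ((2 - CX) a a').toNat) + (∏ᶠ b', z (a, b') ^ ((2 - CY) b b').toNat)
      = z (a, b) ^ 2}

/-- The affine algebraic variety `S(X, Y)`: the Zariski closure of the set of those solutions of
the Hirota equations for which no component vanishes. -/
def hirotaVariety {κ ι : Type} [DecidableEq κ] [DecidableEq ι]
    (CX : Matrix κ κ ℤ) (CY : Matrix ι ι ℤ) : Set (κ × ι → ℂ) :=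
  MvPolynomial.zeroLocus ℂ (MvPolynomial.vanishingIdeal ℂ
    {z : κ × ι → ℂ | z ∈ hirotaSolutions CX CY ∧ ∀ p, z p ≠ 0})

/-- The Pfaffian of a `2m × 2m` matrix,
`Pf A = (2^m m!)⁻¹ ∑_σ sgn σ ∏_{i=1}^m A_{σ(2i-1), σ(2i)}`. -/
def pfaffian {m : ℕ} (A : Matrix (Fin (2 * m)) (Fin (2 * m)) ℂ) : ℂ :=
  ((2 : ℂ) ^ m * (m.factorial : ℂ))⁻¹ *
    ∑ σ : Equiv.Perm (Fin (2 * m)), ((Equiv.Perm.sign σ : ℤ) : ℂ) *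
      ∏ i : Fin m, A (σ ⟨2 * i.val, by omega⟩) (σ ⟨2 * i.val + 1, by omega⟩)

/-- The `n × n` matrix with first row `R₁ 1, R₁ 2, …`, second row `R₂ 1, R₂ 2, …` and
`T_{jk} = T_{j+2,k+2}`; the two sequences are indexed by all integers, and the entries with
`k ≤ 2 < j` are read off at non-positive indices. Rows and columns are counted from `1` in
this description and from `0` by `Fin n`, so odd rows have even `a.val`. -/
def twoPeriodic (n : ℕ) (R₁ R₂ : ℤ → ℂ) : Matrix (Fin n) (Fin n) ℂ :=
  Matrix.of fun a b =>
    if Even a.val then R₁ ((b.val : ℤ) - a.val + 1) else R₂ ((b.val : ℤ) - a.val + 2)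

/-- The numbers `x_0 = 1, x_1, …, x_r`, where `x_j` for `1 ≤ j ≤ r` is the value of
`x : Fin r → ℂ` at `j - 1` (and `0` is used for `j > r`). -/
def dx {r : ℕ} (x : Fin r → ℂ) (j : ℕ) : ℂ :=
  if j = 0 then 1 else if h : j - 1 < r then x ⟨j - 1, h⟩ else 0

/-- `X_{2j+1} = x_j` and `X_{4r-3-2j} = -x_j` for `0 ≤ j ≤ r - 2`, `X_{2j} = -x_j` for
`j = r - 1, r`, and `X_k = 0` otherwise. -/
def dX {r : ℕ} (x : Fin r → ℂ) (k : ℤ) : ℂ :=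
  if Odd k ∧ 1 ≤ k ∧ k ≤ 2 * r - 3 then dx x ((k - 1) / 2).toNat
  else if Odd k ∧ 2 * r + 1 ≤ k ∧ k ≤ 4 * r - 3 then -dx x ((4 * r - 3 - k) / 2).toNat
  else if k = 2 * r - 2 then -dx x (r - 1)
  else if k = 2 * r then -dx x r
  else 0

/-- `Y_2 = 1`, `Y_6 = -1`, `Y_3 = x_r`, `Y_5 = x_{r-1}`, and `Y_k = 0` otherwise. -/
def dY {r : ℕ} (x : Fin r → ℂ) (k : ℤ) : ℂ :=
  if k = 2 then 1 else if k = 6 then -1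
  else if k = 3 then dx x r else if k = 5 then dx x (r - 1) else 0

/-- `T^i_m` for `1 ≤ i ≤ r - 2`, of size `2m - 1`. -/
def dT {r : ℕ} (x : Fin r → ℂ) (i m : ℕ) : Matrix (Fin (2 * m - 1)) (Fin (2 * m - 1)) ℂ :=
  twoPeriodic (2 * m - 1) (fun j => dX x (2 * i + j)) (fun j => dY x j)

/-- `T^{r-1}_m`, of size `2m`. -/
def dTMinus {r : ℕ} (x : Fin r → ℂ) (m : ℕ) : Matrix (Fin (2 * m)) (Fin (2 * m)) ℂ :=
  twoPeriodic (2 * m) (fun j => dY x (3 + j)) (fun j => dX x (2 * r - 3 + j))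

/-- `T^r_m`, of size `2m`. -/
def dTPlus {r : ℕ} (x : Fin r → ℂ) (m : ℕ) : Matrix (Fin (2 * m)) (Fin (2 * m)) ℂ :=
  twoPeriodic (2 * m) (fun j => dX x (2 * r - 2 + j)) (fun j => dY x (2 + j))

/-- The right-hand sides: `det T^i_m` for `i ≤ r - 2`, `Pf T^{r-1}_m` for `i = r - 1` and
`(-1)^m Pf T^r_m` for `i = r`. The node `i` is `a.val + 1`. -/
def dSolution {r : ℕ} (x : Fin r → ℂ) (a : Fin r) (m : ℕ) : ℂ :=
  if a.val + 1 ≤ r - 2 then (dT x (a.val + 1) m).det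
  else if a.val + 1 = r - 1 then pfaffian (dTMinus x m)
  else (-1) ^ m * pfaffian (dTPlus x m)

end

/-!
All matrices in the formulas are finite windows of two doubly infinite arrays, each invariant under
the shift `(a, b) ↦ (a + 2, b + 2)`: `tArray x i`, whose rows alternate between the sequence `X`
shifted by `2 i` and the sequence `Y`, and the alternating array `spinArray x`, whose windows at
offsets `-1` and `0` are the two spinor matrices. The Hirota equations are then classical quadratic
identities between contiguous minors and Pfaffians of these arrays.

At a node `i ≤ r - 2` the Desnanot–Jacobi identity (`minor_mul_minor`) is applied to the window of
size `2 m + 3`. The entry `Y_2 = 1` is the only nonzero entry of many boundary rows and columns, so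
that the minors in the identity are `det T^i` for `m` and `m ± 1`, and two off-diagonal ones. After
exchanging the two rows of each pair, the latter become `± det T^{i-1}` and, for `i < r - 2`,
`± det T^{i+1}`; for `i = r - 2` the second one is an off-diagonal minor of `spinArray`, which is
the product of the two spinor Pfaffians (`minor_succ_eq_pfMinor_mul_pfMinor`). At the spinor nodes a
Pfaffian analogue of Desnanot–Jacobi (`pfMinor_mul_pfMinor`) is used, whose correction term is an
off-diagonal minor that reduces to `det T^{r-2}` because of the isolated entry `Y_6 = -1`.

The Pfaffian identities rest on `Pf (B A Bᵀ) = det B · Pf A` together with the fact that every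
alternating matrix is of the form `C J Cᵀ` with `J` the standard symplectic matrix, and on Schur
complements, invertibility of a block being achieved by a small perturbation.

The Hirota equations determine a solution without zeros from its values at `m = 1`, so such a
solution is given by the formulas. As the formulas are polynomial in `x`, they persist on the
Zariski closure. Conversely, along the curve `x_i = t ^ d_i`, with weights `d` such that `C d > 0`
for the Cartan matrix `C` of `D_r`, the recursion shows that all components are monic in `t`; hence
there is a point `y` at which none of them vanishes. On the line from any `x` to `y` only countably
many points give a solution with a zero, so every polynomial that vanishes on the solutions without
zeros vanishes at the solution attached to `x`.
-/

noncomputable section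

open Matrix Equiv Finset
open scoped Kronecker

/-! ### Pfaffians on paired index sets -/

/-- The Pfaffian of a matrix indexed by `ι × Fin 2`, where the index set is split into the pairs
`{(i, 0), (i, 1)}`. Since permutations of the pairs are even, no order on `ι` is needed. The
defining sum makes sense for all matrices, alternating or not. -/
def pairPf {ι : Type*} [Fintype ι] [DecidableEq ι]
    (A : Matrix (ι × Fin 2) (ι × Fin 2) ℂ) : ℂ :=
  ((2 : ℂ) ^ Fintype.card ι * ((Fintype.card ι).factorial : ℂ))⁻¹ *
    ∑ σ : Perm (ι × Fin 2), ((Perm.sign σ : ℤ) : ℂ) * ∏ i : ι, A (σ (i, 0)) (σ (i, 1))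

/-- The standard symplectic matrix `J` on `ι × Fin 2`: block diagonal, with a block `[0, 1; -1, 0]`
for each pair. -/
def stdSymp (ι : Type*) [DecidableEq ι] : Matrix (ι × Fin 2) (ι × Fin 2) ℂ :=
  (1 : Matrix ι ι ℂ) ⊗ₖ !![0, 1; -1, 0]

section
variable {ι κ τ : Type*} [Fintype ι] [DecidableEq ι] [Fintype κ] [DecidableEq κ]
  [Fintype τ] [DecidableEq τ]

lemma sum_functions_eq_sum_perm {n : Type*} [Fintype n] [DecidableEq n] (F : (n → n) → ℂ)
    (hF : ∀ g, ¬ Function.Injective g → F g = 0) : ∑ g, F g = ∑ σ : Perm n, F σ := by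
  symm
  refine Finset.sum_of_injOn (fun σ : Perm n => (σ : n → n)) ?_ ?_ ?_ ?_
  · exact fun a _ b _ h => DFunLike.coe_injective h
  · simp
  · intro g _ hg
    refine hF g fun hi => hg ?_
    exact ⟨Equiv.ofBijective g (Finite.injective_iff_bijective.1 hi), by simp, rfl⟩
  · simp

/-- Expanding both products turns the sum over permutations into minors of `B` with repeated
columns, which vanish, and `± det B`. No symmetry of `A` is needed. -/
theorem pairPf_mul_mul_transpose (A B : Matrix (ι × Fin 2) (ι × Fin 2) ℂ) :
    pairPf (B * A * Bᵀ) = B.det * pairPf A := by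
  have key : ∀ σ : Perm (ι × Fin 2), ∏ i : ι, (B * A * Bᵀ) (σ (i, 0)) (σ (i, 1)) =
      ∑ g : ι × Fin 2 → ι × Fin 2, (∏ i, A (g (i, 0)) (g (i, 1))) * ∏ p, B (σ p) (g p) := by
    intro σ
    have h1 : ∀ i : ι, (B * A * Bᵀ) (σ (i, 0)) (σ (i, 1)) =
        ∑ h : Fin 2 → ι × Fin 2, A (h 0) (h 1) * ∏ e, B (σ (i, e)) (h e) := by
      intro i
      rw [← Fintype.sum_equiv (finTwoArrowEquiv (ι × Fin 2)).symm
        (fun q => A q.1 q.2 * (B (σ (i, 0)) q.1 * B (σ (i, 1)) q.2)) _ (fun q => by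
          simp [finTwoArrowEquiv, Fin.prod_univ_two])]
      rw [Fintype.sum_prod_type, Matrix.mul_apply, Finset.sum_comm]
      simp only [Matrix.mul_apply, Finset.sum_mul, Matrix.transpose_apply]
      refine Finset.sum_congr rfl fun _ _ => Finset.sum_congr rfl fun _ _ => by ring
    simp only [h1]
    rw [Finset.prod_univ_sum, Fintype.piFinset_univ]
    refine Fintype.sum_equiv (Equiv.curry ι (Fin 2) (ι × Fin 2)).symm _ _ fun h => ?_
    rw [Finset.prod_mul_distrib, Fintype.prod_prod_type]
    rfl
  unfold pairPf
  simp only [key, Finset.mul_sum]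
  rw [Finset.sum_comm]
  rw [sum_functions_eq_sum_perm]
  · refine Finset.sum_congr rfl fun g _ => ?_
    have hd := det_permute' g B
    rw [det_apply'] at hd
    simp only [submatrix_apply, id] at hd
    have : B.det = ((Perm.sign g : ℤ) : ℂ) *
        ∑ σ : Perm (ι × Fin 2), ((Perm.sign σ : ℤ) : ℂ) * ∏ i, B (σ i) (g i) := by
      rw [hd, ← mul_assoc, ← Int.cast_mul, Int.units_coe_mul_self, Int.cast_one, one_mul]
    have h2 : ((Perm.sign g : ℤ) : ℂ) * ((Perm.sign g : ℤ) : ℂ) = 1 := by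
      rw [← Int.cast_mul, Int.units_coe_mul_self, Int.cast_one]
    rw [this, Finset.mul_sum, Finset.sum_mul]
    refine Finset.sum_congr rfl fun σ _ => ?_
    linear_combination (-(2 ^ Fintype.card ι * (Fintype.card ι).factorial : ℂ)⁻¹ *
      ((Perm.sign σ : ℤ) : ℂ) * (∏ i, B (σ i) (g i)) * ∏ i, A (g (i, 0)) (g (i, 1))) * h2
  · intro g hg
    have : (B.submatrix id g).det = 0 := by
      simp only [Function.Injective, not_forall] at hg
      obtain ⟨i, j, hij, hne⟩ := hg
      exact det_zero_of_column_eq hne fun k => by simp [hij]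
    rw [det_apply'] at this
    simp only [submatrix_apply, id] at this
    rw [← mul_zero ((2 ^ Fintype.card ι * (Fintype.card ι).factorial : ℂ)⁻¹ *
      ∏ i, A (g (i, 0)) (g (i, 1))), ← this, Finset.mul_sum]
    exact Finset.sum_congr rfl fun σ _ => by ring

omit [Fintype ι] in
lemma stdSymp_apply (p q : ι × Fin 2) :
    stdSymp ι p q = if p.1 = q.1 then (!![0, 1; -1, 0] : Matrix (Fin 2) (Fin 2) ℂ) p.2 q.2 else 0 := by
  simp [stdSymp, Matrix.one_apply]

omit [Fintype ι] in
lemma stdSymp_transpose : (stdSymp ι)ᵀ = -stdSymp ι := by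
  ext ⟨i, a⟩ ⟨j, b⟩
  simp only [transpose_apply, Matrix.neg_apply, stdSymp_apply, eq_comm (a := j)]
  split_ifs
  · fin_cases a <;> fin_cases b <;> simp
  · simp

lemma det_stdSymp : (stdSymp ι).det = 1 := by
  simp [stdSymp, det_kronecker, det_fin_two]

/-- The permutations of `ι × Fin 2` which permute the pairs `{(i, 0), (i, 1)}`. -/
def pairPerm (τ : Perm ι) (ρ : ι → Perm (Fin 2)) : Perm (ι × Fin 2) :=
  (prodCongrRight ρ).trans (prodCongrLeft fun _ => τ)

omit [Fintype ι] [DecidableEq ι] in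
lemma pairPerm_apply (τ : Perm ι) (ρ : ι → Perm (Fin 2)) (p : ι × Fin 2) :
    pairPerm τ ρ p = (τ p.1, ρ p.1 p.2) := rfl

lemma sign_pairPerm (τ : Perm ι) (ρ : ι → Perm (Fin 2)) :
    Perm.sign (pairPerm τ ρ) = ∏ i, Perm.sign (ρ i) := by
  have : pairPerm τ ρ = prodCongrLeft (fun _ => τ) * prodCongrRight ρ := rfl
  rw [this, Perm.sign_mul, Perm.sign_prodCongrLeft, Perm.sign_prodCongrRight]
  simp

/-- The nonzero terms of the sum belong to the permutations of the pairs, and each of them is `1`. -/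
theorem pairPf_stdSymp : pairPf (stdSymp ι) = 1 := by
  have h : ∑ σ : Perm (ι × Fin 2), ((Perm.sign σ : ℤ) : ℂ) *
      ∏ i : ι, stdSymp ι (σ (i, 0)) (σ (i, 1)) =
      ∑ _q : Perm ι × (ι → Perm (Fin 2)), (1 : ℂ) := by
    symm
    refine Finset.sum_of_injOn (fun q => pairPerm q.1 q.2) ?_ ?_ ?_ ?_
    · rintro ⟨τ, ρ⟩ _ ⟨τ', ρ'⟩ _ h
      have h' : ∀ i a, (τ i, ρ i a) = (τ' i, ρ' i a) := fun i a => Equiv.congr_fun h (i, a)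
      ext i a
      · exact congrArg Prod.fst (h' i 0)
      · exact congrArg (fun q => (Prod.snd q).val) (h' i a)
    · simp
    · intro σ _ hσ
      rw [Finset.prod_eq_zero_iff.2, mul_zero]
      by_contra hne
      simp only [Finset.mem_univ, true_and, stdSymp_apply, not_exists] at hne
      have h1 : ∀ i, (σ (i, 0)).1 = (σ (i, 1)).1 := fun i => by
        by_contra h; exact hne i (if_neg h)
      have h2 : ∀ p, (σ p).1 = (σ (p.1, 0)).1 := by
        rintro ⟨i, a⟩
        fin_cases a
        · rfl
        · exact (h1 i).symm
      have hs : Function.Surjective fun i => (σ (i, 0)).1 := fun c => by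
        obtain ⟨p, hp⟩ := σ.surjective (c, 0)
        exact ⟨p.1, by simp [← h2, hp]⟩
      have hi : ∀ i, Function.Injective fun a => (σ (i, a)).2 := fun i a b hab => by
        have : σ (i, a) = σ (i, b) := Prod.ext ((h2 (i, a)).trans (h2 (i, b)).symm) hab
        simpa using this
      refine hσ ⟨(Equiv.ofBijective _ (Finite.surjective_iff_bijective.1 hs),
        fun i => Equiv.ofBijective _ (Finite.injective_iff_bijective.1 (hi i))), by simp, ?_⟩
      ext p : 1
      exact Prod.ext (h2 p).symm rfl
    · rintro ⟨τ, ρ⟩ _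
      simp only [sign_pairPerm, pairPerm_apply, stdSymp_apply, if_true]
      rw [Units.coe_prod, Int.cast_prod, ← Finset.prod_mul_distrib, Finset.prod_eq_one]
      intro i _
      generalize ρ i = s
      obtain rfl | rfl : s = 1 ∨ s = swap 0 1 := by revert s; decide
      · simp
      · simp
  unfold pairPf
  rw [h]
  have h2 : ((2 : ℂ) ^ Fintype.card ι * ((Fintype.card ι).factorial : ℂ)) ≠ 0 :=
    mul_ne_zero (pow_ne_zero _ two_ne_zero) (by exact_mod_cast Nat.factorial_ne_zero _)
  simp only [Finset.sum_const, Finset.card_univ, Fintype.card_prod, Fintype.card_perm,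
    Fintype.card_pi, Fintype.card_fin, Finset.prod_const, nsmul_eq_mul, mul_one]
  rw [inv_mul_eq_one₀ h2]
  push_cast
  simp [Nat.factorial]
  ring

open Classical in
/-- An alternating matrix with at most `2 m + 1` nonzero rows has rank at most `2 m`, and is the
congruence image of the standard symplectic matrix on `m` pairs under a possibly non-square
matrix. -/
theorem exists_eq_mul_stdSymp_mul_transpose {n : Type*} [Fintype n] (m : ℕ) :
    ∀ A : Matrix n n ℂ, Aᵀ = -A → #{i | A i ≠ 0} ≤ 2 * m + 1 →
      ∃ C : Matrix n (Fin m × Fin 2) ℂ, A = C * stdSymp (Fin m) * Cᵀ := by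
  have hmul : ∀ (k : ℕ) (C : Matrix n (Fin k × Fin 2) ℂ) (i j : n),
      (C * stdSymp (Fin k) * Cᵀ) i j =
        ∑ l, (C i (l, 0) * C j (l, 1) - C i (l, 1) * C j (l, 0)) := by
    intro k C i j
    simp only [Matrix.mul_apply, Fintype.sum_prod_type, Fin.sum_univ_two, stdSymp_apply,
      transpose_apply]
    refine Finset.sum_congr rfl fun l _ => ?_
    simp
    ring
  induction m with
  | zero =>
    intro A hA hc
    refine ⟨0, ?_⟩
    ext i j
    by_contra hne
    have hij : A i j ≠ 0 := by simpa using hne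
    have hji : A j i ≠ 0 := fun h => hij (by
      have := congrFun (congrFun hA j) i
      simpa [h] using this)
    have : i = j := Finset.card_le_one.1 hc i (by
      simpa using fun h => hij (by simp [h])) j (by simpa using fun h => hji (by simp [h]))
    subst this
    have := congrFun (congrFun hA i) i
    simp only [transpose_apply, Matrix.neg_apply] at this
    exact hij (self_eq_neg.1 this)
  | succ m ih =>
    intro A hA hc
    have ha : ∀ i j, A i j = -A j i := fun i j => congrFun (congrFun hA j) i
    by_cases h0 : A = 0
    · exact ⟨0, by simp [h0]⟩
    obtain ⟨i, j, hij⟩ : ∃ i j, A i j ≠ 0 := by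
      by_contra! h
      exact h0 (Matrix.ext h)
    have hii : ∀ k, A k k = 0 := fun k => self_eq_neg.1 (ha k k)
    -- clear the rows and columns `i` and `j` with the pivot `A i j`
    obtain ⟨C, hC⟩ := ih (Matrix.of fun k l =>
        A k l + (A i j)⁻¹ * (A k i * A j l - A k j * A i l)) (by
      ext k l
      simp only [transpose_apply, Matrix.neg_apply, of_apply]
      rw [ha l k, ha l i, ha l j, ha j k, ha i k]
      ring) (by
      have hsub : univ.filter (fun k => (Matrix.of fun k l =>
          A k l + (A i j)⁻¹ * (A k i * A j l - A k j * A i l)) k ≠ 0) ⊆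
          ((univ.filter fun k => A k ≠ 0).erase i).erase j := by
        intro k hk
        simp only [Finset.mem_filter, Finset.mem_univ, true_and, Finset.mem_erase] at hk ⊢
        refine ⟨?_, ?_, ?_⟩
        · rintro rfl
          refine hk (funext fun l => ?_)
          simp only [of_apply, hii, Pi.zero_apply]
          rw [ha k i]
          field_simp
          ring
        · rintro rfl
          refine hk (funext fun l => ?_)
          simp only [of_apply, hii, Pi.zero_apply]
          field_simp
          ring
        · intro h
          refine hk (funext fun l => ?_)
          simp [h]
      have hi : i ∈ univ.filter fun k => A k ≠ 0 := by
        simpa using fun h => hij (by simp [h])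
      have hj : j ∈ (univ.filter fun k => A k ≠ 0).erase i := by
        refine Finset.mem_erase.2 ⟨?_, ?_⟩
        · rintro rfl
          exact hij (hii j)
        · simpa using fun h => hij (by rw [ha]; simp [h])
      have h1 := Finset.card_erase_of_mem hi
      have h2 := Finset.card_erase_of_mem hj
      have h3 := Finset.card_le_card hsub
      omega)
    refine ⟨Matrix.of fun k p => Fin.cases
      (if p.2 = 0 then (A i j)⁻¹ * A k i else A k j)
      (fun l => C k (l, p.2)) p.1, ?_⟩
    ext k l
    have hkl := congrFun (congrFun hC k) l
    rw [hmul] at hkl ⊢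
    rw [Fin.sum_univ_succ]
    simp only [of_apply, Fin.cases_zero, Fin.cases_succ, if_true, one_ne_zero, if_false] at hkl ⊢
    rw [← hkl, ha l i, ha l j]
    ring

theorem exists_eq_mul_stdSymp_mul_transpose' (A : Matrix (ι × Fin 2) (ι × Fin 2) ℂ)
    (hA : Aᵀ = -A) : ∃ C, A = C * stdSymp ι * Cᵀ := by
  classical
  obtain ⟨C, hC⟩ := exists_eq_mul_stdSymp_mul_transpose (Fintype.card ι) A hA (by
    refine (Finset.card_le_univ _).trans ?_
    simp
    omega)
  let e : ι × Fin 2 ≃ Fin (Fintype.card ι) × Fin 2 := (Fintype.equivFin ι).prodCongr (Equiv.refl _)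
  have hJ : (stdSymp (Fin (Fintype.card ι))).submatrix e e = stdSymp ι := by
    ext p q
    simp [stdSymp_apply, e]
  refine ⟨C.submatrix id e, ?_⟩
  rw [← hJ, transpose_submatrix, submatrix_mul_equiv, submatrix_mul_equiv, ← hC, submatrix_id_id]

theorem pairPf_eq_det (C : Matrix (ι × Fin 2) (ι × Fin 2) ℂ) :
    pairPf (C * stdSymp ι * Cᵀ) = C.det := by
  rw [pairPf_mul_mul_transpose, pairPf_stdSymp, mul_one]

theorem pairPf_sq {A : Matrix (ι × Fin 2) (ι × Fin 2) ℂ} (hA : Aᵀ = -A) :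
    pairPf A ^ 2 = A.det := by
  obtain ⟨C, rfl⟩ := exists_eq_mul_stdSymp_mul_transpose' A hA
  rw [pairPf_eq_det, det_mul, det_mul, det_stdSymp, det_transpose]
  ring

/-- The pairs indexed by `κ ⊕ τ` are those indexed by `κ` and those indexed by `τ`. -/
abbrev pairSum (κ τ : Type*) : (κ ⊕ τ) × Fin 2 ≃ κ × Fin 2 ⊕ τ × Fin 2 :=
  Equiv.sumProdDistrib κ τ (Fin 2)

omit [Fintype κ] [Fintype τ] in
lemma stdSymp_sum : stdSymp (κ ⊕ τ) =
    (fromBlocks (stdSymp κ) 0 0 (stdSymp τ)).submatrix (pairSum κ τ) (pairSum κ τ) := by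
  ext ⟨p, a⟩ ⟨q, b⟩
  rcases p with p | p <;> rcases q with q | q <;> simp [stdSymp_apply]

theorem pairPf_fromBlocks_zero {K : Matrix (κ × Fin 2) (κ × Fin 2) ℂ}
    {D : Matrix (τ × Fin 2) (τ × Fin 2) ℂ} (hK : Kᵀ = -K) (hD : Dᵀ = -D) :
    pairPf ((fromBlocks K 0 0 D).submatrix (pairSum κ τ) (pairSum κ τ)) = pairPf K * pairPf D := by
  obtain ⟨C, rfl⟩ := exists_eq_mul_stdSymp_mul_transpose' K hK
  obtain ⟨E, rfl⟩ := exists_eq_mul_stdSymp_mul_transpose' D hD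
  have : (fromBlocks (C * stdSymp κ * Cᵀ) 0 0 (E * stdSymp τ * Eᵀ)).submatrix
      (pairSum κ τ) (pairSum κ τ) =
      (fromBlocks C 0 0 E).submatrix (pairSum κ τ) (pairSum κ τ) * stdSymp (κ ⊕ τ) *
        ((fromBlocks C 0 0 E).submatrix (pairSum κ τ) (pairSum κ τ))ᵀ := by
    rw [stdSymp_sum, transpose_submatrix, submatrix_mul_equiv, submatrix_mul_equiv,
      fromBlocks_transpose, fromBlocks_multiply, fromBlocks_multiply]
    simp
  rw [this, pairPf_eq_det, det_submatrix_equiv_self, det_fromBlocks_zero₂₁, pairPf_eq_det,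
    pairPf_eq_det]

/-- The Schur complement formula for the Pfaffian. -/
theorem pairPf_fromBlocks {K : Matrix (κ × Fin 2) (κ × Fin 2) ℂ}
    {B : Matrix (κ × Fin 2) (τ × Fin 2) ℂ}
    {D : Matrix (τ × Fin 2) (τ × Fin 2) ℂ} (hK : Kᵀ = -K) (hD : Dᵀ = -D) (hdet : IsUnit K.det) :
    pairPf ((fromBlocks K B (-Bᵀ) D).submatrix (pairSum κ τ) (pairSum κ τ)) =
      pairPf K * pairPf (D + Bᵀ * K⁻¹ * B) := by
  have hKi : (K⁻¹)ᵀ = -K⁻¹ := by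
    rw [transpose_nonsing_inv, hK]
    exact inv_eq_left_inv (by rw [neg_mul_neg, nonsing_inv_mul _ hdet])
  have hS : (D + Bᵀ * K⁻¹ * B)ᵀ = -(D + Bᵀ * K⁻¹ * B) := by
    simp only [transpose_add, transpose_mul, transpose_transpose, hKi, hD]
    simp [Matrix.mul_assoc, add_comm]
  rw [← pairPf_fromBlocks_zero hK hS]
  have : (fromBlocks K B (-Bᵀ) D).submatrix (pairSum κ τ) (pairSum κ τ) =
      (fromBlocks 1 0 (-(Bᵀ * K⁻¹)) 1).submatrix (pairSum κ τ) (pairSum κ τ) *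
      (fromBlocks K 0 0 (D + Bᵀ * K⁻¹ * B)).submatrix (pairSum κ τ) (pairSum κ τ) *
      ((fromBlocks 1 0 (-(Bᵀ * K⁻¹)) 1).submatrix (pairSum κ τ) (pairSum κ τ))ᵀ := by
    rw [transpose_submatrix, submatrix_mul_equiv, submatrix_mul_equiv,
      fromBlocks_transpose, fromBlocks_multiply, fromBlocks_multiply]
    congr 1
    simp only [Matrix.one_mul, Matrix.zero_mul, add_zero, Matrix.mul_zero, zero_add,
      transpose_one, transpose_zero, Matrix.mul_one, transpose_neg, transpose_mul,
      transpose_transpose, hKi, Matrix.neg_mul, neg_neg]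
    congr 1
    · rw [← Matrix.mul_assoc, mul_nonsing_inv _ hdet, Matrix.one_mul]
    · rw [Matrix.mul_assoc, nonsing_inv_mul _ hdet, Matrix.mul_one]
    · rw [Matrix.mul_assoc Bᵀ, nonsing_inv_mul _ hdet, Matrix.mul_one]
      simp only [Matrix.mul_assoc]
      abel
  rw [this, pairPf_mul_mul_transpose, det_submatrix_equiv_self, det_fromBlocks_zero₁₂]
  simp

theorem pairPf_unit {D : Matrix (Unit × Fin 2) (Unit × Fin 2) ℂ} (hD : Dᵀ = -D) :
    pairPf D = D ((), 0) ((), 1) := by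
  obtain ⟨C, hC⟩ := exists_eq_mul_stdSymp_mul_transpose' D hD
  rw [hC, pairPf_eq_det, ← det_submatrix_equiv_self (Equiv.punitProd (Fin 2)).symm, det_fin_two]
  simp [Matrix.mul_apply, Fintype.sum_prod_type, Fin.sum_univ_two, stdSymp_apply]
  ring

theorem pairPf_two {D : Matrix (Fin 2 × Fin 2) (Fin 2 × Fin 2) ℂ} (hD : Dᵀ = -D) :
    pairPf D = D (0, 0) (0, 1) * D (1, 0) (1, 1) -
      (D (0, 0) (1, 0) * D (0, 1) (1, 1) - D (0, 0) (1, 1) * D (0, 1) (1, 0)) := by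
  obtain ⟨C, hC⟩ := exists_eq_mul_stdSymp_mul_transpose' D hD
  rw [hC, pairPf_eq_det, ← det_submatrix_equiv_self (finProdFinEquiv (m := 2) (n := 2)).symm]
  have h : ∀ p q, (C * stdSymp (Fin 2) * Cᵀ) p q =
      C p (0, 0) * C q (0, 1) - C p (0, 1) * C q (0, 0) +
      (C p (1, 0) * C q (1, 1) - C p (1, 1) * C q (1, 0)) := by
    intro p q
    simp [Matrix.mul_apply, Fintype.sum_prod_type, Fin.sum_univ_two, stdSymp_apply]
    ring
  simp only [h]
  have e0 : (finProdFinEquiv (m := 2) (n := 2)).symm 0 = (0, 0) := rfl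
  have e1 : (finProdFinEquiv (m := 2) (n := 2)).symm 1 = (0, 1) := rfl
  have e2 : (finProdFinEquiv (m := 2) (n := 2)).symm 2 = (1, 0) := rfl
  have e3 : (finProdFinEquiv (m := 2) (n := 2)).symm 3 = (1, 1) := rfl
  generalize hM : C.submatrix (finProdFinEquiv (m := 2) (n := 2)).symm finProdFinEquiv.symm = M
  have hM' : ∀ i j, M i j = C (finProdFinEquiv.symm i) (finProdFinEquiv.symm j) := by
    intro i j; rw [← hM]; rfl
  rw [← e0, ← e1, ← e2, ← e3]
  simp only [← hM']
  change det (n := Fin 4) M = _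
  rw [det_succ_row_zero]
  simp [det_fin_three, Fin.sum_univ_succ, Fin.succAbove]
  ring

end

/-! ### Identities of Desnanot–Jacobi type -/

section
variable {ι κ τ : Type*} [Fintype ι] [DecidableEq ι] [Fintype κ] [DecidableEq κ]
  [Fintype τ] [DecidableEq τ]

/-- A continuous function of one complex variable which vanishes off a finite set is zero. With
`finite_not_isUnit_det_add_smul` this extends identities from invertible matrices to all. -/
lemma Continuous.eq_zero_of_finite_exceptions {F : ℂ → ℂ} (hF : Continuous F) {s : Set ℂ}
    (hs : s.Finite) (h : ∀ t ∉ s, F t = 0) (t : ℂ) : F t = 0 :=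
  congrFun (hF.ext_on (hs.countable.dense_compl ℝ) continuous_const h) t

lemma finite_not_isUnit_det_add_smul (A : Matrix ι ι ℂ) {J : Matrix ι ι ℂ} (hJ : IsUnit J.det) :
    {t : ℂ | ¬ IsUnit (A + t • J).det}.Finite := by
  have h : ∀ t : ℂ, (A + t • J).det = J.det * (-(J⁻¹ * A)).charpoly.eval t := by
    intro t
    rw [eval_charpoly, ← det_mul]
    congr 1
    rw [Matrix.mul_sub, Matrix.mul_neg, ← Matrix.mul_assoc, mul_nonsing_inv _ hJ, Matrix.one_mul,
      sub_neg_eq_add, add_comm]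
    simp [Matrix.smul_eq_mul_diagonal]
  refine (Polynomial.finite_setOfPred_isRoot (Matrix.charpoly_monic (-(J⁻¹ * A))).ne_zero).subset ?_
  intro t ht
  simp only [Set.mem_ofPred_eq, h, isUnit_iff_ne_zero, not_not, mul_eq_zero] at ht
  exact ht.resolve_left hJ.ne_zero

lemma Continuous.pairPf {A : ℂ → Matrix (ι × Fin 2) (ι × Fin 2) ℂ} (hA : Continuous A) :
    Continuous fun t => pairPf (A t) := by
  unfold _root_.pairPf
  refine continuous_const.mul (continuous_finsetSum _ fun σ _ => continuous_const.mul ?_)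
  exact continuous_finsetProd _ fun i _ => hA.matrix_elem _ _

/-- The Desnanot–Jacobi identity in block form: `A` is bordered by two rows and two columns. -/
theorem det_mul_det_bordered (A : Matrix κ κ ℂ) (B : Matrix κ (Fin 2) ℂ)
    (C : Matrix (Fin 2) κ ℂ) (D : Matrix (Fin 2) (Fin 2) ℂ) :
    (fromBlocks A B C D).det * A.det =
      (fromBlocks A (B.submatrix id fun _ : Unit => 0) (C.submatrix (fun _ : Unit => 0) id)
          (D.submatrix (fun _ => 0) fun _ => 0)).det *
        (fromBlocks A (B.submatrix id fun _ : Unit => 1) (C.submatrix (fun _ : Unit => 1) id)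
          (D.submatrix (fun _ => 1) fun _ => 1)).det -
      (fromBlocks A (B.submatrix id fun _ : Unit => 1) (C.submatrix (fun _ : Unit => 0) id)
          (D.submatrix (fun _ => 0) fun _ => 1)).det *
        (fromBlocks A (B.submatrix id fun _ : Unit => 0) (C.submatrix (fun _ : Unit => 1) id)
          (D.submatrix (fun _ => 1) fun _ => 0)).det := by
  have hA : Continuous fun t : ℂ => A + t • (1 : Matrix κ κ ℂ) := by fun_prop
  have key := Continuous.eq_zero_of_finite_exceptions
    (F := fun t => (fromBlocks (A + t • 1) B C D).det * (A + t • 1).det -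
      ((fromBlocks (A + t • 1) (B.submatrix id fun _ : Unit => 0)
          (C.submatrix (fun _ : Unit => 0) id) (D.submatrix (fun _ => 0) fun _ => 0)).det *
        (fromBlocks (A + t • 1) (B.submatrix id fun _ : Unit => 1)
          (C.submatrix (fun _ : Unit => 1) id) (D.submatrix (fun _ => 1) fun _ => 1)).det -
      (fromBlocks (A + t • 1) (B.submatrix id fun _ : Unit => 1)
          (C.submatrix (fun _ : Unit => 0) id) (D.submatrix (fun _ => 0) fun _ => 1)).det *
        (fromBlocks (A + t • 1) (B.submatrix id fun _ : Unit => 0)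
          (C.submatrix (fun _ : Unit => 1) id) (D.submatrix (fun _ => 1) fun _ => 0)).det))
    (by
      have h1 := (hA.matrix_fromBlocks continuous_const continuous_const continuous_const
        (B := fun _ => B) (C := fun _ => C) (D := fun _ => D)).matrix_det
      have h2 : ∀ (B : Matrix κ Unit ℂ) (C : Matrix Unit κ ℂ) (D : Matrix Unit Unit ℂ),
          Continuous fun t : ℂ => (fromBlocks (A + t • 1) B C D).det := fun B C D =>
        (hA.matrix_fromBlocks continuous_const continuous_const continuous_const).matrix_det
      exact (h1.mul hA.matrix_det).sub (((h2 _ _ _).mul (h2 _ _ _)).sub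
        ((h2 _ _ _).mul (h2 _ _ _))))
    (finite_not_isUnit_det_add_smul A (J := 1) (by simp)) (by
      intro t ht
      simp only [Set.mem_ofPred_eq, not_not] at ht
      set K := A + t • (1 : Matrix κ κ ℂ)
      have : Invertible K := invertibleOfIsUnitDet K ht
      simp only [det_fromBlocks₁₁, det_unique, det_fin_two, Matrix.sub_apply, Matrix.mul_apply,
        submatrix_apply, id]
      ring) 0
  rw [← sub_eq_zero]
  simpa using key

lemma pairPf_mul_pairPf_of_isUnit {A : Matrix ((κ ⊕ Fin 2) × Fin 2) ((κ ⊕ Fin 2) × Fin 2) ℂ}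
    (hA : Aᵀ = -A)
    (hu : IsUnit (A.submatrix (Prod.map Sum.inl id) (Prod.map Sum.inl id) :
      Matrix (κ × Fin 2) (κ × Fin 2) ℂ).det) :
    pairPf A * pairPf (A.submatrix (Prod.map Sum.inl id) (Prod.map Sum.inl id)) =
      pairPf (A.submatrix (Prod.map (Sum.map id fun _ : Unit => 0) id)
          (Prod.map (Sum.map id fun _ : Unit => 0) id)) *
        pairPf (A.submatrix (Prod.map (Sum.map id fun _ : Unit => 1) id)
          (Prod.map (Sum.map id fun _ : Unit => 1) id)) -
      (A.submatrix (Prod.map (Sum.map id fun _ : Unit => 0) id)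
        (Prod.map (Sum.map id fun _ : Unit => 1) id)).det := by
  have ha : ∀ p q, A p q = -A q p := fun p q => congrFun (congrFun hA q) p
  set K : Matrix (κ × Fin 2) (κ × Fin 2) ℂ :=
    A.submatrix (Prod.map Sum.inl id) (Prod.map Sum.inl id) with hKdef
  set B : Matrix (κ × Fin 2) (Fin 2 × Fin 2) ℂ :=
    A.submatrix (Prod.map Sum.inl id) (Prod.map Sum.inr id) with hBdef
  set D : Matrix (Fin 2 × Fin 2) (Fin 2 × Fin 2) ℂ :=
    A.submatrix (Prod.map Sum.inr id) (Prod.map Sum.inr id) with hDdef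
  have hK : Kᵀ = -K := by ext p q; exact ha _ _
  have hD : Dᵀ = -D := by ext p q; exact ha _ _
  let f : Fin 2 → Unit × Fin 2 → Fin 2 × Fin 2 := fun j => Prod.map (fun _ => j) id
  have hA1 : A = (fromBlocks K B (-Bᵀ) D).submatrix (pairSum κ (Fin 2)) (pairSum κ (Fin 2)) := by
    ext ⟨p, a⟩ ⟨q, b⟩
    rcases p with p | p <;> rcases q with q | q
    · rfl
    · rfl
    · exact ha _ _
    · rfl
  have hA2 : ∀ i j, A.submatrix (Prod.map (Sum.map id fun _ : Unit => i) id)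
      (Prod.map (Sum.map id fun _ : Unit => j) id) =
      (fromBlocks K (B.submatrix id (f j)) (-(B.submatrix id (f i))ᵀ)
        (D.submatrix (f i) (f j))).submatrix (pairSum κ Unit) (pairSum κ Unit) := by
    intro i j
    ext ⟨p, a⟩ ⟨q, b⟩
    rcases p with p | p <;> rcases q with q | q
    · rfl
    · rfl
    · exact ha _ _
    · rfl
  have hD2 : ∀ j, (D.submatrix (f j) (f j))ᵀ = -D.submatrix (f j) (f j) := by
    intro j; ext p q; exact ha _ _
  have hKi : (K⁻¹)ᵀ = -K⁻¹ := by
    rw [transpose_nonsing_inv, hK]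
    exact inv_eq_left_inv (by rw [neg_mul_neg, nonsing_inv_mul _ hu])
  set S := D + Bᵀ * K⁻¹ * B with hSdef
  have hS : Sᵀ = -S := by
    rw [hSdef]
    simp only [transpose_add, transpose_mul, transpose_transpose, hKi, hD]
    simp [Matrix.mul_assoc, add_comm]
  have hS2 : ∀ i j, D.submatrix (f i) (f j) + (B.submatrix id (f i))ᵀ * K⁻¹ * B.submatrix id (f j) =
      S.submatrix (f i) (f j) := fun i j => rfl
  have hS3 : ∀ j, (S.submatrix (f j) (f j))ᵀ = -S.submatrix (f j) (f j) := by
    intro j; ext p q; exact congrFun (congrFun hS _) _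
  have hdet : (A.submatrix (Prod.map (Sum.map id fun _ : Unit => 0) id)
      (Prod.map (Sum.map id fun _ : Unit => 1) id)).det =
      K.det * (S.submatrix (f 0) (f 1)).det := by
    have : Invertible K := invertibleOfIsUnitDet K hu
    rw [hA2, det_submatrix_equiv_self, det_fromBlocks₁₁, ← hS2, invOf_eq_nonsing_inv,
      Matrix.neg_mul, Matrix.neg_mul, sub_neg_eq_add]
  rw [hdet, hA2, hA2, pairPf_fromBlocks hK (hD2 _) hu, pairPf_fromBlocks hK (hD2 _) hu, hS2, hS2,
    pairPf_unit (hS3 _), pairPf_unit (hS3 _)]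
  conv_lhs => rw [hA1, pairPf_fromBlocks hK hD hu, ← hSdef, pairPf_two hS]
  rw [← pairPf_sq hK, ← det_submatrix_equiv_self (Equiv.punitProd (Fin 2)).symm, det_fin_two]
  simp only [f, submatrix_apply, Prod.map, id, Equiv.punitProd_symm_apply]
  ring

/-- A Pfaffian analogue of the Desnanot–Jacobi identity: `A` is an alternating matrix on the pairs
`κ` and two further pairs, and the determinant is that of the rows `κ` and the first extra pair,
and the columns `κ` and the second one. -/
theorem pairPf_mul_pairPf {A : Matrix ((κ ⊕ Fin 2) × Fin 2) ((κ ⊕ Fin 2) × Fin 2) ℂ}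
    (hA : Aᵀ = -A) :
    pairPf A * pairPf (A.submatrix (Prod.map Sum.inl id) (Prod.map Sum.inl id)) =
      pairPf (A.submatrix (Prod.map (Sum.map id fun _ : Unit => 0) id)
          (Prod.map (Sum.map id fun _ : Unit => 0) id)) *
        pairPf (A.submatrix (Prod.map (Sum.map id fun _ : Unit => 1) id)
          (Prod.map (Sum.map id fun _ : Unit => 1) id)) -
      (A.submatrix (Prod.map (Sum.map id fun _ : Unit => 0) id)
        (Prod.map (Sum.map id fun _ : Unit => 1) id)).det := by
  let P : ℂ → Matrix ((κ ⊕ Fin 2) × Fin 2) ((κ ⊕ Fin 2) × Fin 2) ℂ :=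
    fun t => A + t • stdSymp (κ ⊕ Fin 2)
  have hP : Continuous P := by fun_prop
  have hPt : ∀ t, (P t)ᵀ = -P t := fun t => by
    simp only [P, transpose_add, transpose_smul, stdSymp_transpose, hA, smul_neg, neg_add]
  have key := Continuous.eq_zero_of_finite_exceptions
    (F := fun t =>
      pairPf (P t) * pairPf ((P t).submatrix (Prod.map Sum.inl id) (Prod.map Sum.inl id)) -
      (pairPf ((P t).submatrix (Prod.map (Sum.map id fun _ : Unit => 0) id)
          (Prod.map (Sum.map id fun _ : Unit => 0) id)) *
        pairPf ((P t).submatrix (Prod.map (Sum.map id fun _ : Unit => 1) id)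
          (Prod.map (Sum.map id fun _ : Unit => 1) id)) -
      ((P t).submatrix (Prod.map (Sum.map id fun _ : Unit => 0) id)
        (Prod.map (Sum.map id fun _ : Unit => 1) id)).det))
    ((hP.pairPf.mul (hP.matrix_submatrix _ _).pairPf).sub
      (((hP.matrix_submatrix _ _).pairPf.mul (hP.matrix_submatrix _ _).pairPf).sub
        (hP.matrix_submatrix _ _).matrix_det))
    (finite_not_isUnit_det_add_smul
      (A.submatrix (Prod.map Sum.inl id) (Prod.map Sum.inl id)) (J := stdSymp κ)
      (by rw [det_stdSymp]; exact isUnit_one)) (by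
      intro t ht
      simp only [Set.mem_ofPred_eq, not_not] at ht
      rw [sub_eq_zero]
      refine pairPf_mul_pairPf_of_isUnit (hPt t) ?_
      convert ht using 2
      ext p q
      simp [P, stdSymp_apply]) 0
  rw [← sub_eq_zero]
  simpa [P] using key

/-! ### Contiguous minors -/

theorem pairPf_submatrix_equiv (e : ι ≃ κ) (A : Matrix (κ × Fin 2) (κ × Fin 2) ℂ) :
    pairPf (A.submatrix (Prod.map e id) (Prod.map e id)) = pairPf A := by
  unfold pairPf
  rw [Fintype.card_congr e]
  congr 1
  let E : ι × Fin 2 ≃ κ × Fin 2 := e.prodCongr (Equiv.refl _)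
  refine Fintype.sum_equiv E.permCongr _ _ fun σ => ?_
  rw [Perm.sign_permCongr]
  congr 1
  refine Fintype.prod_equiv e _ _ fun i => ?_
  simp [E]

/-- The bijection `(i, a) ↦ 2 i + a`. -/
def pairIndex (m : ℕ) : Fin m × Fin 2 ≃ Fin (2 * m) :=
  finProdFinEquiv.trans (finCongr (mul_comm m 2))

lemma pairIndex_val {m : ℕ} (p : Fin m × Fin 2) : (pairIndex m p).val = 2 * p.1.val + p.2.val := by
  simp [pairIndex, finProdFinEquiv, add_comm]

theorem pfaffian_eq_pairPf {m : ℕ} (A : Matrix (Fin (2 * m)) (Fin (2 * m)) ℂ) :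
    pfaffian A = pairPf (A.submatrix (pairIndex m) (pairIndex m)) := by
  unfold pfaffian pairPf
  rw [Fintype.card_fin]
  congr 1
  refine Fintype.sum_equiv (pairIndex m).symm.permCongr _ _ fun σ => ?_
  rw [Perm.sign_permCongr]
  congr 1
  refine Finset.prod_congr rfl fun i _ => ?_
  have h0 : pairIndex m (i, 0) = ⟨2 * i.val, by omega⟩ := Fin.ext (by simp [pairIndex_val])
  have h1 : pairIndex m (i, 1) = ⟨2 * i.val + 1, by omega⟩ := Fin.ext (by simp [pairIndex_val])
  simp [h0, h1]

/-- The minor of the array `f` on `n` consecutive rows from `a` and `n` consecutive columns from `b`. -/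
def minor (f : ℤ → ℤ → ℂ) (n : ℕ) (a b : ℤ) : ℂ :=
  det (Matrix.of fun i j : Fin n => f (a + i.val) (b + j.val))

/-- The Pfaffian of the window of size `2 m` of the array `f` on the rows and columns from `a`. -/
def pfMinor (f : ℤ → ℤ → ℂ) (m : ℕ) (a : ℤ) : ℂ :=
  pfaffian (Matrix.of fun i j : Fin (2 * m) => f (a + i.val) (a + j.val))

omit [DecidableEq ι] in
lemma exists_equiv_fin_of_offset {n : ℕ} (hι : Fintype.card ι = n) {g : ι → ℤ}
    (hg : Function.Injective g) {a : ℤ} (h : ∀ i, a ≤ g i ∧ g i < a + n) :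
    ∃ e : ι ≃ Fin n, ∀ i, g i = a + (e i).val := by
  let φ : ι → Fin n := fun i => ⟨(g i - a).toNat, by have := h i; omega⟩
  have hφ : ∀ i, g i = a + (φ i).val := fun i => by
    have := h i
    simp only [φ]
    omega
  have hi : Function.Injective φ := fun i j hij => hg (by rw [hφ i, hφ j, hij])
  exact ⟨Equiv.ofBijective φ ((Fintype.bijective_iff_injective_and_card φ).2
    ⟨hi, by rw [hι, Fintype.card_fin]⟩), hφ⟩

/-- Three ways to list consecutive integers: with both end points, the first point, or the last
point separated from the rest. -/
lemma exists_middle_equiv (n : ℕ) :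
    (∃ e : Fin n ⊕ Fin 2 ≃ Fin (n + 2), (∀ i, (e (.inl i)).val = i.val + 1) ∧
      (e (.inr 0)).val = 0 ∧ (e (.inr 1)).val = n + 1) ∧
    (∃ e : Fin n ⊕ Unit ≃ Fin (n + 1), (∀ i, (e (.inl i)).val = i.val + 1) ∧
      (e (.inr ())).val = 0) ∧
    (∃ e : Fin n ⊕ Unit ≃ Fin (n + 1), (∀ i, (e (.inl i)).val = i.val) ∧
      (e (.inr ())).val = n) := by
  refine ⟨?_, ?_, ?_⟩
  · obtain ⟨e, he⟩ := exists_equiv_fin_of_offset (ι := Fin n ⊕ Fin 2) (n := n + 2) (a := 0)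
      (g := Sum.elim (fun i => i.val + 1) ![0, n + 1]) (by simp) (by
        rintro (i | i) (j | j) h
        · simp at h
          congr; omega
        · fin_cases j <;> simp at h <;> omega
        · fin_cases i <;> simp at h <;> omega
        · fin_cases i <;> fin_cases j <;> simp at h ⊢ <;> omega) (by
        rintro (i | i)
        · simp; omega
        · fin_cases i <;> simp <;> omega)
    have h0 := he (.inr 0)
    have h1 := he (.inr 1)
    refine ⟨e, fun i => ?_, ?_, ?_⟩
    · have := he (.inl i)
      simp at this; omega
    · simp only [Sum.elim_inr, Matrix.cons_val_zero] at h0; omega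
    · simp at h1; omega
  · refine ⟨(Equiv.sumComm _ _).trans ((Equiv.sumCongr ?_ (Equiv.refl _)).trans
      (finSumFinEquiv.trans (finCongr (add_comm 1 n)))), ?_, ?_⟩
    · exact Equiv.ofUnique _ _
    · intro i; simp
    · simp
  · refine ⟨(Equiv.sumCongr (Equiv.refl _) ?_).trans finSumFinEquiv, ?_, ?_⟩
    · exact Equiv.ofUnique _ _
    · intro i; simp
    · simp

lemma det_submatrix_equiv_equiv (e e' : ι ≃ κ) (N : Matrix κ κ ℂ) :
    (N.submatrix e e').det = ((Perm.sign (e'.symm.trans e) : ℤ) : ℂ) * N.det := by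
  rw [← det_permute, ← det_submatrix_equiv_self e' (N.submatrix _ id)]
  congr 1
  ext i j
  simp

/-- The Desnanot–Jacobi identity for contiguous minors. -/
theorem minor_mul_minor (f : ℤ → ℤ → ℂ) (n : ℕ) (a b : ℤ) :
    minor f (n + 2) a b * minor f n (a + 1) (b + 1) =
      minor f (n + 1) a b * minor f (n + 1) (a + 1) (b + 1) -
        minor f (n + 1) a (b + 1) * minor f (n + 1) (a + 1) b := by
  obtain ⟨⟨e, hel, he0, he1⟩, ⟨u, hul, hur⟩, ⟨v, hvl, hvr⟩⟩ := exists_middle_equiv n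
  have key := det_mul_det_bordered (Matrix.of fun i j : Fin n => f (a + 1 + i.val) (b + 1 + j.val))
    (Matrix.of fun i j => f (a + 1 + i.val) (b + (e (.inr j)).val))
    (Matrix.of fun i j => f (a + (e (.inr i)).val) (b + 1 + j.val))
    (Matrix.of fun i j => f (a + (e (.inr i)).val) (b + (e (.inr j)).val))
  have h0 : minor f (n + 2) a b = _ := (det_submatrix_equiv_self e _).symm
  have h00 : minor f (n + 1) a b = _ := (det_submatrix_equiv_self u _).symm
  have h11 : minor f (n + 1) (a + 1) (b + 1) = _ := (det_submatrix_equiv_self v _).symm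
  have h01 := det_submatrix_equiv_equiv u v
    (Matrix.of fun i j : Fin (n + 1) => f (a + i.val) (b + 1 + j.val))
  have h10 := det_submatrix_equiv_equiv v u
    (Matrix.of fun i j : Fin (n + 1) => f (a + 1 + i.val) (b + j.val))
  have hs : Perm.sign (u.symm.trans v) = Perm.sign (v.symm.trans u) := by
    rw [← Perm.sign_symm]; rfl
  have hs2 : ((Perm.sign (v.symm.trans u) : ℤ) : ℂ) * ((Perm.sign (v.symm.trans u) : ℤ) : ℂ) = 1 := by
    rw [← Int.cast_mul, Int.units_coe_mul_self, Int.cast_one]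
  rw [hs] at h10
  have hprod : minor f (n + 1) a (b + 1) * minor f (n + 1) (a + 1) b =
      ((Matrix.of fun i j : Fin (n + 1) => f (a + i.val) (b + 1 + j.val)).submatrix u v).det *
      ((Matrix.of fun i j : Fin (n + 1) => f (a + 1 + i.val) (b + j.val)).submatrix v u).det := by
    rw [h01, h10]
    unfold minor
    linear_combination -(Matrix.of fun i j : Fin (n + 1) => f (a + i.val) (b + 1 + j.val)).det *
      (Matrix.of fun i j : Fin (n + 1) => f (a + 1 + i.val) (b + j.val)).det * hs2
  rw [hprod, h0, h00, h11]
  have hc : minor f n (a + 1) (b + 1) =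
      (Matrix.of fun i j : Fin n => f (a + 1 + i.val) (b + 1 + j.val)).det := rfl
  rw [hc]
  refine (congrArg₂ (· * ·) ?_ rfl).trans (key.trans (congrArg₂ (· - ·)
    (congrArg₂ (· * ·) ?_ ?_) (congrArg₂ (· * ·) ?_ ?_)))
  all_goals
    congr 1
    ext (i | i) (j | j) <;> simp [hel, he0, he1, hul, hur, hvl, hvr, add_comm, add_left_comm]

/-- The window of odd size `2 m + 1` of an alternating array has the form `C J Cᵀ` with `2 m` columns
in `C`, and both sides are the product of the two maximal minors of `C` that omit its last, or its
first, row. -/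
theorem minor_succ_eq_pfMinor_mul_pfMinor {f : ℤ → ℤ → ℂ} (hf : ∀ a b, f a b = -f b a) (m : ℕ)
    (a : ℤ) : minor f (2 * m) a (a + 1) = pfMinor f m a * pfMinor f m (a + 1) := by
  classical
  obtain ⟨C, hC⟩ := exists_eq_mul_stdSymp_mul_transpose m
    (Matrix.of fun i j : Fin (2 * m + 1) => f (a + i.val) (a + j.val))
    (by ext i j; exact hf _ _) ((Finset.card_le_univ _).trans (by simp))
  have hsub : ∀ s t : Fin m × Fin 2 → Fin (2 * m + 1),
      (Matrix.of fun p q => f (a + (s p).val) (a + (t q).val)) =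
        C.submatrix s id * stdSymp (Fin m) * (C.submatrix t id)ᵀ := by
    intro s t
    have : (Matrix.of fun i j : Fin (2 * m + 1) => f (a + i.val) (a + j.val)).submatrix s t =
        (C * stdSymp (Fin m) * Cᵀ).submatrix s t := by rw [hC]
    rw [← submatrix_mul_equiv _ _ s (Equiv.refl _) t, ← submatrix_mul_equiv _ _ s (Equiv.refl _)]
      at this
    exact this
  have h0 := hsub (fun p => (pairIndex m p).castSucc) (fun p => (pairIndex m p).castSucc)
  have h1 := hsub (fun p => (pairIndex m p).succ) (fun p => (pairIndex m p).succ)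
  have h01 := hsub (fun p => (pairIndex m p).castSucc) (fun p => (pairIndex m p).succ)
  have e0 : pfMinor f m a = (C.submatrix (fun p => (pairIndex m p).castSucc) id).det := by
    rw [← pairPf_eq_det, ← h0, pfMinor, pfaffian_eq_pairPf]
    rfl
  have e1 : pfMinor f m (a + 1) = (C.submatrix (fun p => (pairIndex m p).succ) id).det := by
    rw [← pairPf_eq_det, ← h1, pfMinor, pfaffian_eq_pairPf]
    congr 1
    ext p q
    simp [add_assoc, add_comm]
  rw [e0, e1, minor, ← det_submatrix_equiv_self (pairIndex m)]
  rw [← det_transpose (C.submatrix (fun p => (pairIndex m p).succ) id)]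
  rw [show ∀ x y : ℂ, x * y = x * (stdSymp (Fin m)).det * y from fun x y => by
    rw [det_stdSymp, mul_one], ← det_mul, ← det_mul, ← h01]
  congr 1
  ext p q
  simp [add_assoc, add_comm]

/-- The Pfaffian analogue of the Desnanot–Jacobi identity for contiguous windows: two rows and
columns are removed at either end. -/
theorem pfMinor_mul_pfMinor {f : ℤ → ℤ → ℂ} (hf : ∀ a b, f a b = -f b a) (m : ℕ) (a : ℤ) :
    pfMinor f (m + 2) a * pfMinor f m (a + 2) =
      pfMinor f (m + 1) a * pfMinor f (m + 1) (a + 2) - minor f (2 * (m + 1)) a (a + 2) := by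
  obtain ⟨⟨e, hel, he0, he1⟩, ⟨u, hul, hur⟩, ⟨v, hvl, hvr⟩⟩ := exists_middle_equiv m
  have hpf : ∀ (k : ℕ) (b : ℤ), pfMinor f k b = pairPf (Matrix.of fun p q : Fin k × Fin 2 =>
      f (b + 2 * p.1.val + p.2.val) (b + 2 * q.1.val + q.2.val)) := by
    intro k b
    rw [pfMinor, pfaffian_eq_pairPf]
    congr 1
    ext p q
    simp [pairIndex_val, add_assoc]
  have hdet : minor f (2 * (m + 1)) a (a + 2) = det (Matrix.of fun p q : Fin (m + 1) × Fin 2 =>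
      f (a + 2 * p.1.val + p.2.val) (a + 2 + 2 * q.1.val + q.2.val)) := by
    rw [minor, ← det_submatrix_equiv_self (pairIndex (m + 1))]
    congr 1
    ext p q
    simp [pairIndex_val, add_assoc]
  have hdet' := det_submatrix_equiv_equiv (u.prodCongr (Equiv.refl (Fin 2)))
    (v.prodCongr (Equiv.refl (Fin 2))) (Matrix.of fun p q : Fin (m + 1) × Fin 2 =>
      f (a + 2 * p.1.val + p.2.val) (a + 2 + 2 * q.1.val + q.2.val))
  have hsign : Perm.sign ((v.prodCongr (Equiv.refl (Fin 2))).symm.trans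
      (u.prodCongr (Equiv.refl (Fin 2)))) = 1 := by
    have : (v.prodCongr (Equiv.refl (Fin 2))).symm.trans (u.prodCongr (Equiv.refl (Fin 2))) =
        prodCongrLeft fun _ => v.symm.trans u := by ext p <;> simp
    rw [this, Perm.sign_prodCongrLeft]
    simp
  rw [hsign, Units.val_one, Int.cast_one, one_mul] at hdet'
  rw [hdet, ← hdet', hpf, hpf, hpf, hpf, ← pairPf_submatrix_equiv e,
    ← pairPf_submatrix_equiv u, ← pairPf_submatrix_equiv v]
  have key := pairPf_mul_pairPf (A := ((Matrix.of fun p q : Fin (m + 2) × Fin 2 =>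
      f (a + 2 * p.1.val + p.2.val) (a + 2 * q.1.val + q.2.val)).submatrix
        (Prod.map e id) (Prod.map e id))) (by ext p q; exact hf _ _)
  refine (congrArg₂ (· * ·) rfl ?_).trans (key.trans (congrArg₂ (· - ·)
    (congrArg₂ (· * ·) ?_ ?_) ?_))
  · congr 1
    ext ⟨i, c⟩ ⟨j, d⟩
    simp [hel, mul_add, add_assoc, add_comm, add_left_comm]
  · congr 1
    ext ⟨i | i, c⟩ ⟨j | j, d⟩ <;> simp [hel, hul, hur, he0]
  · congr 1
    ext ⟨i | i, c⟩ ⟨j | j, d⟩ <;>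
      simp [hel, hvl, hvr, he1, mul_add, add_assoc, add_comm, add_left_comm]
  · congr 1
    ext ⟨i | i, c⟩ ⟨j | j, d⟩ <;>
      simp [hel, hvl, hvr, hul, hur, he0, he1, mul_add, add_assoc, add_comm, add_left_comm]

end

/-! ### Expansions of contiguous minors -/

section
variable {f g : ℤ → ℤ → ℂ}

lemma minor_zero (f : ℤ → ℤ → ℂ) (a b : ℤ) : minor f 0 a b = 1 := det_isEmpty

lemma minor_congr {n : ℕ} {a b a' b' : ℤ}
    (h : ∀ i j : ℤ, f (a + i) (b + j) = g (a' + i) (b' + j)) : minor f n a b = minor g n a' b' := by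
  unfold minor
  simp only [h]

lemma minor_transpose (f : ℤ → ℤ → ℂ) (n : ℕ) (a b : ℤ) :
    minor f n a b = minor (fun u v => f v u) n b a := by
  unfold minor
  rw [← det_transpose]
  rfl

lemma minor_succ_of_first_column {n : ℕ} {a b : ℤ} (h : ∀ u, a < u → f u b = 0) :
    minor f (n + 1) a b = f a b * minor f n (a + 1) (b + 1) := by
  unfold minor
  rw [det_succ_column_zero, Finset.sum_eq_single 0]
  · simp only [of_apply, Fin.val_zero, pow_zero, one_mul, Nat.cast_zero, add_zero]
    congr 2
    ext i j
    simp [add_assoc, add_comm (1 : ℤ)]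
  · intro i _ hi
    have : 0 < i.val := Nat.pos_of_ne_zero fun h => hi (Fin.ext h)
    have h0 := h (a + i.val) (by omega)
    simp [h0]
  · simp

lemma minor_succ_of_first_row {n : ℕ} {a b : ℤ} (h : ∀ v, b < v → f a v = 0) :
    minor f (n + 1) a b = f a b * minor f n (a + 1) (b + 1) := by
  rw [minor_transpose, minor_succ_of_first_column h, ← minor_transpose]

lemma minor_succ_of_last_column {n : ℕ} {a b : ℤ}
    (h : ∀ u, a ≤ u → u < a + n → f u (b + n) = 0) :
    minor f (n + 1) a b = f (a + n) (b + n) * minor f n a b := by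
  unfold minor
  rw [det_succ_column _ (Fin.last n), Finset.sum_eq_single (Fin.last n)]
  · rw [Even.neg_one_pow ⟨_, rfl⟩]
    simp only [of_apply, one_mul, Fin.val_last]
    congr 2
    ext i j
    simp
  · intro i _ hi
    have : i.val < n := Fin.val_lt_last hi
    have h0 := h (a + i.val) (by omega) (by omega)
    simp [h0]
  · simp

lemma minor_succ_of_last_row {n : ℕ} {a b : ℤ}
    (h : ∀ v, b ≤ v → v < b + n → f (a + n) v = 0) :
    minor f (n + 1) a b = f (a + n) (b + n) * minor f n a b := by
  rw [minor_transpose, minor_succ_of_last_column h, ← minor_transpose]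

lemma minor_comm_of_alternating (hf : ∀ a b, f a b = -f b a) (n : ℕ) (a b : ℤ) :
    minor f n a b = (-1) ^ n * minor f n b a := by
  rw [minor_transpose, minor, minor]
  have : (Matrix.of fun i j : Fin n => f (a + j.val) (b + i.val)) =
      -(Matrix.of fun i j : Fin n => f (b + i.val) (a + j.val)) := by
    ext i j
    exact hf _ _
  rw [this, det_neg, Fintype.card_fin]

/-- Exchanging the two rows of each of `m` consecutive pairs of rows gives the sign `(-1) ^ m`. -/
lemma minor_of_swap_rows {a b a' b' : ℤ} (m : ℕ)
    (h0 : ∀ k j : ℤ, f (a + 2 * k) (b + j) = g (a' + 2 * k + 1) (b' + j))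
    (h1 : ∀ k j : ℤ, f (a + 2 * k + 1) (b + j) = g (a' + 2 * k) (b' + j)) :
    minor f (2 * m) a b = (-1) ^ m * minor g (2 * m) a' b' := by
  unfold minor
  rw [← det_submatrix_equiv_self (pairIndex m), ← det_submatrix_equiv_self (pairIndex m)
    (Matrix.of fun i j : Fin (2 * m) => g (a' + i.val) (b' + j.val))]
  have hs : ((Perm.sign (prodCongrRight fun _ : Fin m => swap (0 : Fin 2) 1) : ℤ) : ℂ) =
      (-1) ^ m := by
    rw [Perm.sign_prodCongrRight]
    simp
  rw [← hs, ← det_permute]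
  congr 1
  ext ⟨i, c⟩ ⟨j, d⟩
  simp only [submatrix_apply, of_apply, pairIndex_val, id, prodCongrRight_apply]
  push_cast
  fin_cases c
  · simpa [add_assoc] using h0 i (2 * j + d.val)
  · simpa [add_assoc] using h1 i (2 * j + d.val)

end

/-! ### The two arrays and their minors -/

section
variable {r : ℕ}

/-- The doubly infinite array whose window at the origin is `T^i`. The rows are counted from `0`, so
the even ones carry the sequence `X`; `i` may be any integer. -/
def tArray (x : Fin r → ℂ) (i : ℤ) (a b : ℤ) : ℂ :=
  if Even a then dX x (2 * i + (b - a + 1)) else dY x (b - a + 2)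

/-- The doubly infinite alternating array whose window at `0` is `T^r` and whose window at `-1` is
`T^{r-1}`. -/
def spinArray (x : Fin r → ℂ) (a b : ℤ) : ℂ :=
  if Even a then dX x (2 * r - 2 + (b - a + 1)) else dY x (2 + (b - a + 2))

variable (x : Fin r → ℂ)

lemma dY_two : dY x 2 = 1 := by simp [dY]

lemma dY_six : dY x 6 = -1 := by simp [dY]

lemma dY_of_lt_two {k : ℤ} (h : k < 2) : dY x k = 0 := by
  unfold dY
  rw [if_neg, if_neg, if_neg, if_neg] <;> omega

lemma dY_of_six_lt {k : ℤ} (h : 6 < k) : dY x k = 0 := by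
  unfold dY
  rw [if_neg, if_neg, if_neg, if_neg] <;> omega

lemma dX_of_even {k : ℤ} (hk : Even k) (h1 : k ≠ 2 * r - 2) (h2 : k ≠ 2 * r) : dX x k = 0 := by
  unfold dX
  rw [if_neg, if_neg, if_neg h1, if_neg h2] <;> simp [hk]

lemma dX_of_lt_one (hr : 3 ≤ r) {k : ℤ} (h : k < 1) : dX x k = 0 := by
  unfold dX
  rw [if_neg, if_neg, if_neg, if_neg] <;> omega

lemma dX_one (hr : 3 ≤ r) : dX x 1 = 1 := by
  unfold dX
  rw [if_pos ⟨by decide, le_rfl, by omega⟩]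
  simp [dx]

lemma dX_reflect {d : ℤ} (hd : Even d) :
    dX x (2 * r - 1 + d) = -dX x (2 * r - 1 - d) := by
  obtain ⟨k, rfl⟩ := hd
  have h1 : Odd (2 * (r : ℤ) - 1 + (k + k)) := ⟨r - 1 + k, by ring⟩
  have h2 : Odd (2 * (r : ℤ) - 1 - (k + k)) := ⟨r - 1 - k, by ring⟩
  unfold dX
  simp only [h1, h2, true_and]
  split_ifs <;> first | omega | simp
  all_goals congr 2; omega

lemma dX_eq_neg_dY {d : ℤ} (hd : Odd d) :
    dX x (2 * r - 1 + d) = -dY x (4 - d) := by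
  obtain ⟨k, rfl⟩ := hd
  have h1 : ¬ Odd (2 * (r : ℤ) - 1 + (2 * k + 1)) := by
    rw [Int.not_odd_iff_even]
    exact ⟨r + k, by ring⟩
  unfold dX dY
  simp only [h1, false_and, if_false]
  split_ifs <;> first | omega | simp

lemma dY_reflect {d : ℤ} (hd : Even d) : dY x (4 + d) = -dY x (4 - d) := by
  obtain ⟨k, rfl⟩ := hd
  unfold dY
  split_ifs <;> first | omega | simp

lemma spinArray_alternating (a b : ℤ) : spinArray x a b = -spinArray x b a := by
  unfold spinArray
  split_ifs with ha hb hb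
  · have h := dX_reflect x (hb.sub ha)
    rw [show 2 * (r : ℤ) - 2 + (b - a + 1) = 2 * r - 1 + (b - a) by ring, h]
    ring_nf
  · have h := dX_eq_neg_dY x ((Int.not_even_iff_odd.1 hb).sub_even ha)
    rw [show 2 * (r : ℤ) - 2 + (b - a + 1) = 2 * r - 1 + (b - a) by ring, h]
    ring_nf
  · have h := dX_eq_neg_dY x ((Int.not_even_iff_odd.1 ha).sub_even hb)
    rw [show 2 * (r : ℤ) - 2 + (a - b + 1) = 2 * r - 1 + (a - b) by ring, h]
    ring_nf
  · have h := dY_reflect x ((Int.not_even_iff_odd.1 hb).sub_odd (Int.not_even_iff_odd.1 ha))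
    rw [show 2 + (b - a + 2) = 4 + (b - a) by ring, h]
    ring_nf

lemma tArray_add_two (i a b : ℤ) : tArray x i (a + 2) (b + 2) = tArray x i a b := by
  unfold tArray
  simp only [show Even (a + 2) ↔ Even a by simp]
  ring_nf

lemma spinArray_add_two (a b : ℤ) : spinArray x (a + 2) (b + 2) = spinArray x a b := by
  unfold spinArray
  simp only [show Even (a + 2) ↔ Even a by simp]
  ring_nf

lemma minor_tArray_add_two (i : ℤ) (n : ℕ) (a b : ℤ) :
    minor (tArray x i) n (a + 2) (b + 2) = minor (tArray x i) n a b :=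
  minor_congr fun k l => by rw [add_right_comm, add_right_comm b, tArray_add_two]

/-- The last row of the left-hand window is `0, …, 0, Y_2 = 1`. -/
lemma minor_tArray_even (i : ℤ) (m : ℕ) :
    minor (tArray x i) (2 * m + 2) 0 0 = minor (tArray x i) (2 * m + 1) 0 0 := by
  have ho : ¬ Even (0 + ((2 * m + 1 : ℕ) : ℤ)) := by simp
  rw [minor_succ_of_last_row]
  · simp only [tArray, if_neg ho]
    rw [show (0 + ((2 * m + 1 : ℕ) : ℤ) - (0 + ((2 * m + 1 : ℕ) : ℤ)) + 2) = 2 by ring, dY_two,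
      one_mul]
  · intro v _ hv
    simp only [tArray, if_neg ho]
    exact dY_of_lt_two x (by omega)

/-- The first column of the left-hand window is `Y_2 = 1, 0, …, 0`, as `X` vanishes at the even
indices below `2 r - 2`. -/
lemma minor_tArray_one_one {i : ℤ} (hi : i ≤ r - 2) (n : ℕ) :
    minor (tArray x i) (n + 1) 1 1 = minor (tArray x i) n 0 0 := by
  rw [minor_succ_of_first_column]
  · have := minor_tArray_add_two x i n 0 0
    norm_num at this
    simp [this, tArray, dY_two]
  · intro u hu
    unfold tArray
    split_ifs with h
    · exact dX_of_even x (by rw [show 2 * i + (1 - u + 1) = 2 * (i + 1) - u by ring]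
                             exact (even_two_mul _).sub h) (by omega) (by omega)
    · exact dY_of_lt_two x (by omega)

lemma minor_tArray_one_zero (i : ℤ) (m : ℕ) :
    minor (tArray x i) (2 * m) 1 0 = (-1) ^ m * minor (tArray x (i - 1)) (2 * m) 0 0 := by
  refine minor_of_swap_rows m ?_ ?_
  · intro k j
    have h1 : ¬ Even (1 + 2 * k) := by simp [Int.even_add]
    have h2 : ¬ Even (0 + 2 * k + 1) := by simp
    simp only [tArray, if_neg h1, if_neg h2]
    ring_nf
  · intro k j
    have h1 : Even (1 + 2 * k + 1) := ⟨k + 1, by ring⟩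
    have h2 : Even (0 + 2 * k) := by simp
    simp only [tArray, if_pos h1, if_pos h2]
    ring_nf

lemma minor_tArray_zero_one (i : ℤ) (m : ℕ) :
    minor (tArray x i) (2 * m) 0 1 = (-1) ^ m * minor (tArray x (i + 1)) (2 * m) 1 1 := by
  refine minor_of_swap_rows m ?_ ?_
  · intro k j
    have h1 : Even (1 + 2 * k + 1) := ⟨k + 1, by ring⟩
    have h2 : Even (0 + 2 * k) := by simp
    simp only [tArray, if_pos h1, if_pos h2]
    ring_nf
  · intro k j
    have h1 : ¬ Even (1 + 2 * k) := by simp [Int.even_add]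
    have h2 : ¬ Even (0 + 2 * k + 1) := by simp
    simp only [tArray, if_neg h1, if_neg h2]
    ring_nf

/-- The window of `T^0` is upper triangular with unit diagonal, in accordance with `z_{0m} = 1`. -/
lemma minor_tArray_zero (hr : 3 ≤ r) (m : ℕ) : minor (tArray x 0) (2 * m) 0 0 = 1 := by
  induction m with
  | zero => exact minor_zero _ _ _
  | succ m ih =>
    have he : Even (0 + ((2 * m : ℕ) : ℤ)) := by simp
    rw [show 2 * (m + 1) = 2 * m + 2 by ring, minor_tArray_even, minor_succ_of_last_row, ih]
    · simp only [tArray, if_pos he]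
      simp [dX_one x hr]
    · intro v _ hv
      simp only [tArray, if_pos he]
      exact dX_of_lt_one x hr (by omega)

lemma minor_tArray_sq {i : ℤ} (hi : i ≤ r - 2) (m : ℕ) :
    minor (tArray x i) (2 * (m + 2)) 0 0 * minor (tArray x i) (2 * m) 0 0 =
      minor (tArray x i) (2 * (m + 1)) 0 0 ^ 2 -
        minor (tArray x i) (2 * (m + 1)) 0 1 * minor (tArray x i) (2 * (m + 1)) 1 0 := by
  have h := minor_mul_minor (tArray x i) (2 * m + 1) 0 0
  simp only [zero_add] at h
  rw [minor_tArray_one_one x hi, minor_tArray_one_one x hi, ← minor_tArray_even,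
    show 2 * m + 1 + 2 = 2 * (m + 1) + 1 by ring, ← minor_tArray_even,
    show 2 * m + 1 + 1 = 2 * (m + 1) by ring] at h
  rw [show 2 * (m + 2) = 2 * (m + 1) + 2 by ring, h]
  ring_nf

lemma minor_spinArray_two_zero (n : ℕ) :
    minor (spinArray x) n 2 0 = minor (tArray x (r - 2)) n 0 0 := by
  refine minor_congr fun a b => ?_
  unfold spinArray tArray
  simp only [show Even (2 + a) ↔ Even (0 + a) by simp [Int.even_add]]
  ring_nf

lemma neg_minor_spinArray_zero_two (m : ℕ) :
    -minor (spinArray x) (2 * m + 1) 0 2 = minor (tArray x (r - 2)) (2 * (m + 1)) 0 0 := by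
  rw [show 2 * (m + 1) = 2 * m + 2 by ring, minor_tArray_even, ← minor_spinArray_two_zero,
    minor_comm_of_alternating (spinArray_alternating x), Odd.neg_one_pow ⟨m, rfl⟩]
  ring

lemma minor_spinArray_neg_one_one (m : ℕ) :
    minor (spinArray x) (2 * (m + 1)) (-1) 1 = minor (tArray x (r - 2)) (2 * (m + 1)) 0 0 := by
  have ho : ¬ Even (-1 : ℤ) := by decide
  rw [← neg_minor_spinArray_zero_two x, show 2 * (m + 1) = 2 * m + 1 + 1 by ring,
    minor_succ_of_first_row]
  · simp [spinArray, dY_six]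
  · intro v hv
    simp only [spinArray, if_neg ho]
    exact dY_of_six_lt x (by omega)

lemma minor_spinArray_zero_two (m : ℕ) :
    minor (spinArray x) (2 * (m + 1)) 0 2 = minor (tArray x (r - 2)) (2 * (m + 1)) 0 0 := by
  have ho : ¬ Even (0 + ((2 * m + 1 : ℕ) : ℤ)) := by simp
  rw [← neg_minor_spinArray_zero_two x, show 2 * (m + 1) = 2 * m + 1 + 1 by ring,
    minor_succ_of_last_column]
  · simp only [spinArray, if_neg ho]
    rw [show (2 + (2 + ((2 * m + 1 : ℕ) : ℤ) - (0 + ((2 * m + 1 : ℕ) : ℤ)) + 2)) = 6 by ring, dY_six,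
      neg_one_mul]
  · intro u _ hu
    push_cast at hu ⊢
    unfold spinArray
    split_ifs with h
    · obtain ⟨k, rfl⟩ := h
      exact dX_of_even x ⟨r + m + 1 - k, by ring⟩ (by omega) (by omega)
    · obtain ⟨k, rfl⟩ := Int.not_even_iff_odd.1 h
      exact dY_of_six_lt x (by omega)

/-- At the branch node, the second off-diagonal minor is the product of the spinor Pfaffians. -/
lemma minor_tArray_zero_one_eq_pfMinor (m : ℕ) :
    minor (tArray x (r - 2)) (2 * m) 0 1 =
      pfMinor (spinArray x) m (-1) * pfMinor (spinArray x) m 0 := by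
  have h := minor_succ_eq_pfMinor_mul_pfMinor (spinArray_alternating x) m (-1)
  norm_num at h
  rw [← h, minor_comm_of_alternating (spinArray_alternating x),
    Even.neg_one_pow (even_two_mul m), one_mul]
  refine minor_congr fun a b => ?_
  unfold spinArray tArray
  ring_nf

lemma pfMinor_spinArray_add_two (m : ℕ) (a : ℤ) :
    pfMinor (spinArray x) m (a + 2) = pfMinor (spinArray x) m a := by
  unfold pfMinor
  congr 1
  ext i j
  simp only [of_apply]
  rw [add_right_comm a 2 (i.val : ℤ), add_right_comm a 2 (j.val : ℤ), spinArray_add_two]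

lemma pfMinor_spinArray_sq (m : ℕ) (a : ℤ) :
    pfMinor (spinArray x) (m + 2) a * pfMinor (spinArray x) m a =
      pfMinor (spinArray x) (m + 1) a ^ 2 - minor (spinArray x) (2 * (m + 1)) a (a + 2) := by
  have h := pfMinor_mul_pfMinor (spinArray_alternating x) m a
  rw [pfMinor_spinArray_add_two, pfMinor_spinArray_add_two] at h
  rw [h, sq]

/-! ### Values at `m = 0` and `m = 1` -/

lemma det_dT (i m : ℕ) : (dT x i m).det = minor (tArray x i) (2 * m) 0 0 := by
  cases m with
  | zero => rw [minor_zero]; exact det_isEmpty (n := Fin 0)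
  | succ m =>
    change _ = minor (tArray x i) (2 * m + 2) 0 0
    rw [minor_tArray_even, minor]
    change det (n := Fin (2 * m + 1)) _ = _
    congr 1
    ext a b
    simp [dT, twoPeriodic, tArray]

lemma dTPlus_eq (m : ℕ) : dTPlus x m = Matrix.of fun i j : Fin (2 * m) =>
    spinArray x (0 + i.val) (0 + j.val) := by
  ext a b
  simp [dTPlus, twoPeriodic, spinArray]

lemma dTMinus_eq (m : ℕ) : dTMinus x m = Matrix.of fun i j : Fin (2 * m) =>
    spinArray x (-1 + i.val) (-1 + j.val) := by
  ext a b
  simp only [dTMinus, twoPeriodic, spinArray, of_apply]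
  have h : Even (-1 + (a.val : ℤ)) ↔ ¬ Even a.val := by
    rw [Int.even_add]
    simp
  by_cases ha : Even a.val
  · rw [if_pos ha, if_neg (by rw [h]; exact not_not.2 ha)]
    ring_nf
  · rw [if_neg ha, if_pos (h.2 ha)]
    ring_nf

lemma pfaffian_dTPlus (m : ℕ) : pfaffian (dTPlus x m) = pfMinor (spinArray x) m 0 := by
  rw [dTPlus_eq, pfMinor]

lemma pfaffian_dTMinus (m : ℕ) : pfaffian (dTMinus x m) = pfMinor (spinArray x) m (-1) := by
  rw [dTMinus_eq, pfMinor]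

lemma pfMinor_zero (f : ℤ → ℤ → ℂ) (a : ℤ) : pfMinor f 0 a = 1 := by
  simp [pfMinor, pfaffian]

lemma pfMinor_one {f : ℤ → ℤ → ℂ} (hf : ∀ a b, f a b = -f b a) (a : ℤ) :
    pfMinor f 1 a = f a (a + 1) := by
  rw [pfMinor, pfaffian_eq_pairPf, ← pairPf_submatrix_equiv (Equiv.ofUnique Unit (Fin 1)),
    pairPf_unit]
  · have h0 : (pairIndex 1 (0, 0)).val = 0 := pairIndex_val _
    have h1 : (pairIndex 1 (0, 1)).val = 1 := pairIndex_val _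
    simp only [submatrix_apply, Prod.map, of_apply, id]
    rw [show (Equiv.ofUnique Unit (Fin 1)) () = 0 from rfl, h0, h1]
    simp
  · ext p q
    exact hf _ _

lemma dSolution_of_le {a : Fin r} (h : a.val + 1 ≤ r - 2) (m : ℕ) :
    dSolution x a m = minor (tArray x (a.val + 1 : ℕ)) (2 * m) 0 0 := by
  rw [dSolution, if_pos h, det_dT]

lemma dSolution_minus (hr : 3 ≤ r) {a : Fin r} (h : a.val + 2 = r) (m : ℕ) :
    dSolution x a m = pfMinor (spinArray x) m (-1) := by
  rw [dSolution, if_neg (by omega), if_pos (by omega), pfaffian_dTMinus]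

lemma dSolution_plus (hr : 3 ≤ r) {a : Fin r} (h : a.val + 1 = r) (m : ℕ) :
    dSolution x a m = (-1) ^ m * pfMinor (spinArray x) m 0 := by
  rw [dSolution, if_neg (by omega), if_neg (by omega), pfaffian_dTPlus]

lemma dSolution_zero (a : Fin r) : dSolution x a 0 = 1 := by
  unfold dSolution
  rw [pfaffian_dTMinus, pfaffian_dTPlus, pfMinor_zero, pfMinor_zero, det_dT, minor_zero]
  simp

lemma dX_node {k : ℕ} (hk : k + 1 ≤ r - 2) (hr : k < r) : dX x (2 * (k + 1) + 1) = x ⟨k, hr⟩ := by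
  unfold dX
  rw [if_pos ⟨⟨k + 1, rfl⟩, by omega, by omega⟩, dx]
  have : ((2 * ((k : ℤ) + 1) + 1 - 1) / 2).toNat = k + 1 := by omega
  rw [this]
  simp [hr]

lemma dSolution_one (hr : 3 ≤ r) (a : Fin r) : dSolution x a 1 = x a := by
  by_cases h1 : a.val + 1 ≤ r - 2
  · rw [dSolution_of_le x h1, ← dX_node x h1 a.isLt]
    change minor _ (2 * 0 + 2) 0 0 = _
    rw [minor_tArray_even, minor]
    change det (n := Fin 1) _ = _
    simp [tArray]
  by_cases h2 : a.val + 2 = r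
  · rw [dSolution_minus x hr h2, pfMinor_one (spinArray_alternating x)]
    have h5 : (r : ℕ) - 1 = a.val + 1 := by omega
    simp [spinArray, dY, dx, h5]
  · have h3 : a.val + 1 = r := by omega
    rw [dSolution_plus x hr h3, pfMinor_one (spinArray_alternating x)]
    have ho : ¬ Odd (2 * (r : ℤ) - 2 + (1 + 1)) := by simp [Int.odd_iff]
    have hx : dx x r = x a := by
      unfold dx
      rw [if_neg (by omega), dif_pos (by omega)]
      congr 1
      ext
      simp
      omega
    simp only [spinArray, dX, Even.zero, if_true]
    rw [if_neg (by omega), if_neg (by omega), if_neg (by omega), if_pos (by ring), hx]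
    simp

end

/-! ### The Hirota equations -/

section
variable {r : ℕ} {M : Type*} [CommMonoid M]

/-- The product of the values of `w` at the neighbours of the node `a` of `D_r`. -/
def neighborProd (w : Fin r → M) (a : Fin r) : M :=
  ∏ a', w a' ^ ((2 - CartanMatrix.D r) a a').toNat

/-- The values of `w` at the nodes `1, …, r` counted from one, extended by `1`; thus the missing
left neighbour `0` of the node `1` contributes a trivial factor. -/
def extendNodes (w : Fin r → M) (j : ℕ) : M :=
  if h : 1 ≤ j ∧ j ≤ r then w ⟨j - 1, by omega⟩ else 1

lemma extendNodes_succ (w : Fin r → M) (a : Fin r) : extendNodes w (a.val + 1) = w a := by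
  simp [extendNodes]

lemma extendNodes_zero (w : Fin r → M) : extendNodes w 0 = 1 := by simp [extendNodes]

/-- Adjacency in `D_r` of nodes counted from one, also satisfied by `1` and the fictitious node `0`. -/
def adjacentD (r i j : ℕ) : Prop :=
  (i + 1 = j ∧ j + 1 < r) ∨ (j + 1 = i ∧ i + 1 < r) ∨
    (i + 2 = r ∧ (j + 1 = r ∨ j = r)) ∨ (j + 2 = r ∧ (i + 1 = r ∨ i = r))

open Classical in
lemma neighborProd_eq (hr : 3 ≤ r) (w : Fin r → M) (a : Fin r) (s : Finset ℕ)
    (hs : ∀ j, j ∈ s ↔ j ≤ r ∧ adjacentD r (a.val + 1) j) :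
    neighborProd w a = ∏ j ∈ s, extendNodes w j := by
  have h1 : ∀ a' : Fin r, w a' ^ ((2 - CartanMatrix.D r) a a').toNat =
      if adjacentD r (a.val + 1) (a'.val + 1) then extendNodes w (a'.val + 1) else 1 := by
    intro a'
    rw [extendNodes_succ]
    have : (2 - CartanMatrix.D r) a a' =
        if adjacentD r (a.val + 1) (a'.val + 1) then 1 else 0 := by
      simp only [Matrix.sub_apply, CartanMatrix.D, of_apply, Matrix.ofNat_apply, adjacentD,
        Fin.ext_iff]
      split_ifs <;> omega
    rw [this]
    split_ifs <;> simp
  unfold neighborProd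
  rw [Finset.prod_congr rfl fun a' _ => h1 a']
  rw [Fin.prod_univ_eq_prod_range (fun j => if adjacentD r (a.val + 1) (j + 1) then
    extendNodes w (j + 1) else 1) r]
  have h2 := Finset.prod_range_succ' (fun j => if adjacentD r (a.val + 1) j then
    extendNodes w j else 1) r
  rw [show (if adjacentD r (a.val + 1) 0 then extendNodes w 0 else 1) = 1 by
    simp [extendNodes_zero], mul_one] at h2
  rw [← h2, ← Finset.prod_filter]
  congr 1
  ext j
  simp [hs]

lemma neighborProd_chain (w : Fin r → M) {a : Fin r} (h : a.val + 3 < r) :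
    neighborProd w a = extendNodes w a.val * extendNodes w (a.val + 2) := by
  classical
  rw [neighborProd_eq (by omega) w a {a.val, a.val + 2}, Finset.prod_pair (by omega)]
  intro j
  simp only [Finset.mem_insert, Finset.mem_singleton, adjacentD]
  omega

lemma neighborProd_branch (hr : 3 ≤ r) (w : Fin r → M) {a : Fin r} (h : a.val + 3 = r) :
    neighborProd w a =
      extendNodes w a.val * (extendNodes w (r - 1) * extendNodes w r) := by
  classical
  rw [neighborProd_eq (by omega) w a {a.val, r - 1, r}, Finset.prod_insert,
    Finset.prod_pair (by omega)]
  · simp only [Finset.mem_insert, Finset.mem_singleton]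
    omega
  intro j
  simp only [Finset.mem_insert, Finset.mem_singleton, adjacentD]
  omega

lemma neighborProd_spin (hr : 3 ≤ r) (w : Fin r → M) {a : Fin r} (h : r ≤ a.val + 2) :
    neighborProd w a = extendNodes w (r - 2) := by
  classical
  rw [neighborProd_eq (by omega) w a {r - 2}, Finset.prod_singleton]
  intro j
  simp only [Finset.mem_singleton, adjacentD]
  omega

end

section
variable {r : ℕ}

/-- The Hirota equations for the formulas, with the value `dSolution x a 0 = 1` at `m = 0`. -/
theorem dSolution_recursion (hr : 3 ≤ r) (x : Fin r → ℂ) (m : ℕ) (a : Fin r) :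
    neighborProd (fun a' => dSolution x a' (m + 1)) a + dSolution x a m * dSolution x a (m + 2) =
      dSolution x a (m + 1) ^ 2 := by
  have hlow : ∀ j ≤ r - 2, extendNodes (fun a' => dSolution x a' (m + 1)) j =
      minor (tArray x j) (2 * (m + 1)) 0 0 := by
    intro j hj
    cases j with
    | zero => rw [extendNodes_zero, Nat.cast_zero, minor_tArray_zero x hr]
    | succ k =>
      have := extendNodes_succ (fun a' => dSolution x a' (m + 1)) ⟨k, by omega⟩
      simp only at this
      rw [this, dSolution_of_le x hj]
  have hminus : extendNodes (fun a' => dSolution x a' (m + 1)) (r - 1) =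
      pfMinor (spinArray x) (m + 1) (-1) := by
    have := extendNodes_succ (fun a' => dSolution x a' (m + 1)) ⟨r - 2, by omega⟩
    simp only at this
    rw [show r - 1 = r - 2 + 1 by omega, this, dSolution_minus x hr]
    simp only
    omega
  have hplus : extendNodes (fun a' => dSolution x a' (m + 1)) r =
      (-1) ^ (m + 1) * pfMinor (spinArray x) (m + 1) 0 := by
    have := extendNodes_succ (fun a' => dSolution x a' (m + 1)) ⟨r - 1, by omega⟩
    simp only at this
    rw [Nat.sub_add_cancel (by omega)] at this
    rw [this, dSolution_plus x hr (Nat.sub_add_cancel (by omega))]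
  have hsign : ((-1 : ℂ) ^ m) ^ 2 = 1 := by rw [← pow_mul, mul_comm, pow_mul]; simp
  by_cases h1 : a.val + 1 ≤ r - 2
  · rw [dSolution_of_le x h1, dSolution_of_le x h1, dSolution_of_le x h1]
    have hD := minor_tArray_sq x (i := (a.val + 1 : ℕ)) (by omega) m
    have hL := minor_tArray_one_zero x (a.val + 1 : ℕ) (m + 1)
    rw [show ((a.val + 1 : ℕ) : ℤ) - 1 = (a.val : ℕ) by push_cast; ring] at hL
    by_cases h2 : a.val + 3 < r
    · rw [neighborProd_chain _ h2, hlow _ (by omega), hlow _ (by omega)]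
      have hU := minor_tArray_zero_one x (a.val + 1 : ℕ) (m + 1)
      rw [show ((a.val + 1 : ℕ) : ℤ) + 1 = (a.val + 2 : ℕ) by push_cast; ring,
        show 2 * (m + 1) = 2 * m + 1 + 1 by ring, minor_tArray_one_one x (by omega),
        ← minor_tArray_even, show 2 * m + 2 = 2 * (m + 1) by ring] at hU
      rw [hU, hL] at hD
      linear_combination hD + (-minor (tArray x a.val) (2 * (m + 1)) 0 0 *
        minor (tArray x (a.val + 2 : ℕ)) (2 * (m + 1)) 0 0) * hsign
    · have h3 : a.val + 3 = r := by omega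
      rw [neighborProd_branch hr _ h3, hlow _ (by omega), hminus, hplus]
      have hU := minor_tArray_zero_one_eq_pfMinor x (m + 1)
      rw [show (r : ℤ) - 2 = (a.val + 1 : ℕ) by omega] at hU
      rw [hU, hL] at hD
      linear_combination hD
  have hr2 : extendNodes (fun a' => dSolution x a' (m + 1)) (r - 2) =
      minor (tArray x (r - 2)) (2 * (m + 1)) 0 0 := by
    rw [hlow _ le_rfl, Nat.cast_sub (by omega)]
    rfl
  rw [neighborProd_spin hr _ (by omega), hr2]
  by_cases h2 : a.val + 2 = r
  · rw [dSolution_minus x hr h2, dSolution_minus x hr h2, dSolution_minus x hr h2]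
    have h := pfMinor_spinArray_sq x m (-1)
    norm_num at h
    rw [minor_spinArray_neg_one_one] at h
    linear_combination h
  · have h3 : a.val + 1 = r := by omega
    rw [dSolution_plus x hr h3, dSolution_plus x hr h3, dSolution_plus x hr h3]
    have h := pfMinor_spinArray_sq x m 0
    rw [zero_add, minor_spinArray_zero_two] at h
    rw [pow_succ (-1 : ℂ) m, pow_add (-1 : ℂ) m 2]
    linear_combination h + (pfMinor (spinArray x) m 0 * pfMinor (spinArray x) (m + 2) 0 -
      pfMinor (spinArray x) (m + 1) 0 ^ 2) * hsign

end

/-! ### The formulas are polynomial -/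

section
variable {r : ℕ}

/-- The algebra of polynomial functions on `σ → ℂ`. -/
def polyFunctions (σ : Type*) : Subalgebra ℂ ((σ → ℂ) → ℂ) :=
  (MvPolynomial.aeval (R := ℂ) fun (i : σ) (x : σ → ℂ) => x i).range

lemma mem_polyFunctions {σ : Type*} {F : (σ → ℂ) → ℂ} :
    F ∈ polyFunctions σ ↔ ∃ Q : MvPolynomial σ ℂ, ∀ x, MvPolynomial.aeval x Q = F x := by
  have h : ∀ (Q : MvPolynomial σ ℂ) (x : σ → ℂ),
      MvPolynomial.aeval (R := ℂ) (fun (i : σ) (x : σ → ℂ) => x i) Q x =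
        MvPolynomial.aeval x Q := by
    intro Q x
    have : (Pi.evalAlgHom ℂ (fun _ : σ → ℂ => ℂ) x).comp
        (MvPolynomial.aeval (R := ℂ) fun (i : σ) (x : σ → ℂ) => x i) = MvPolynomial.aeval x := by
      ext i
      simp
    exact DFunLike.congr_fun this Q
  simp only [polyFunctions, AlgHom.mem_range, funext_iff, h]

lemma const_mem_polyFunctions {σ : Type*} (c : ℂ) :
    (fun _ : σ → ℂ => c) ∈ polyFunctions σ :=
  (polyFunctions σ).algebraMap_mem c

lemma dx_mem_polyFunctions (j : ℕ) :
    (fun x : Fin r → ℂ => dx x j) ∈ polyFunctions (Fin r) := by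
  unfold dx
  split_ifs with h0 h
  · exact const_mem_polyFunctions 1
  · exact mem_polyFunctions.2 ⟨MvPolynomial.X ⟨j - 1, h⟩, fun x => by simp⟩
  · exact const_mem_polyFunctions 0

lemma dX_mem_polyFunctions (k : ℤ) :
    (fun x : Fin r → ℂ => dX x k) ∈ polyFunctions (Fin r) := by
  unfold dX
  split_ifs
  · exact dx_mem_polyFunctions _
  · exact neg_mem (dx_mem_polyFunctions _)
  · exact neg_mem (dx_mem_polyFunctions _)
  · exact neg_mem (dx_mem_polyFunctions _)
  · exact const_mem_polyFunctions 0

lemma dY_mem_polyFunctions (k : ℤ) :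
    (fun x : Fin r → ℂ => dY x k) ∈ polyFunctions (Fin r) := by
  unfold dY
  split_ifs
  · exact const_mem_polyFunctions 1
  · exact const_mem_polyFunctions (-1)
  · exact dx_mem_polyFunctions _
  · exact dx_mem_polyFunctions _
  · exact const_mem_polyFunctions 0

lemma twoPeriodic_mem_polyFunctions {n : ℕ} {P Q : (Fin r → ℂ) → ℤ → ℂ}
    (hP : ∀ k, (fun x => P x k) ∈ polyFunctions (Fin r))
    (hQ : ∀ k, (fun x => Q x k) ∈ polyFunctions (Fin r)) (a b : Fin n) :
    (fun x => twoPeriodic n (P x) (Q x) a b) ∈ polyFunctions (Fin r) := by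
  simp only [twoPeriodic, of_apply]
  split_ifs
  · exact hP _
  · exact hQ _

lemma det_mem_polyFunctions {σ n : Type*} [Fintype n] [DecidableEq n]
    {A : (σ → ℂ) → Matrix n n ℂ} (hA : ∀ i j, (fun x => A x i j) ∈ polyFunctions σ) :
    (fun x => (A x).det) ∈ polyFunctions σ := by
  have : (fun x => (A x).det) = ∑ s : Perm n, (fun _ => ((Perm.sign s : ℤ) : ℂ)) *
      ∏ i, fun x => A x (s i) i := by
    ext x
    simp [det_apply']
  rw [this]
  exact sum_mem fun s _ => mul_mem (const_mem_polyFunctions _) (prod_mem fun i _ => hA _ _)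

lemma pfaffian_mem_polyFunctions {σ : Type*} {m : ℕ}
    {A : (σ → ℂ) → Matrix (Fin (2 * m)) (Fin (2 * m)) ℂ}
    (hA : ∀ i j, (fun x => A x i j) ∈ polyFunctions σ) :
    (fun x => pfaffian (A x)) ∈ polyFunctions σ := by
  have : (fun x => pfaffian (A x)) = (fun _ => ((2 : ℂ) ^ m * (m.factorial : ℂ))⁻¹) *
      ∑ s : Perm (Fin (2 * m)), (fun _ => ((Perm.sign s : ℤ) : ℂ)) *
      ∏ i : Fin m, fun x => A x (s ⟨2 * i.val, by omega⟩) (s ⟨2 * i.val + 1, by omega⟩) := by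
    ext x
    simp [pfaffian]
  rw [this]
  exact mul_mem (const_mem_polyFunctions _) (sum_mem fun s _ =>
    mul_mem (const_mem_polyFunctions _) (prod_mem fun i _ => hA _ _))

lemma dSolution_mem_polyFunctions (a : Fin r) (m : ℕ) :
    (fun x => dSolution x a m) ∈ polyFunctions (Fin r) := by
  unfold dSolution
  split_ifs
  · exact det_mem_polyFunctions fun i j => twoPeriodic_mem_polyFunctions
      (fun k => dX_mem_polyFunctions _) (fun k => dY_mem_polyFunctions _) i j
  · exact pfaffian_mem_polyFunctions fun i j => twoPeriodic_mem_polyFunctions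
      (fun k => dY_mem_polyFunctions _) (fun k => dX_mem_polyFunctions _) i j
  · exact mul_mem (const_mem_polyFunctions ((-1) ^ m))
      (pfaffian_mem_polyFunctions fun i j => twoPeriodic_mem_polyFunctions
      (fun k => dX_mem_polyFunctions _) (fun k => dY_mem_polyFunctions _) i j)

/-- A polynomial in `x` with value `dSolution x a m`. -/
def dPolynomial (a : Fin r) (m : ℕ) : MvPolynomial (Fin r) ℂ :=
  (mem_polyFunctions.1 (dSolution_mem_polyFunctions a m)).choose

lemma aeval_dPolynomial (x : Fin r → ℂ) (a : Fin r) (m : ℕ) :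
    MvPolynomial.aeval x (dPolynomial a m) = dSolution x a m :=
  (mem_polyFunctions.1 (dSolution_mem_polyFunctions a m)).choose_spec x

lemma eval_aeval_dPolynomial (v : Fin r → Polynomial ℂ) (a : Fin r) (m : ℕ) (t : ℂ) :
    (MvPolynomial.aeval v (dPolynomial a m)).eval t =
      dSolution (fun j => (v j).eval t) a m := by
  rw [← aeval_dPolynomial, ← Polynomial.coe_aeval_eq_eval, ← AlgHom.comp_apply,
    MvPolynomial.comp_aeval]

end

/-! ### A solution without zeros -/

lemma exists_forall_eval_ne_zero {ι : Type*} [Countable ι] {q : ι → Polynomial ℂ}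
    (hq : ∀ i, q i ≠ 0) : ∃ t : ℂ, ∀ i, (q i).eval t ≠ 0 := by
  by_contra! h
  have : (Set.univ : Set ℂ) ⊆ ⋃ i, {t | (q i).IsRoot t} := fun t _ => by
    obtain ⟨i, hi⟩ := h t
    exact Set.mem_iUnion.2 ⟨i, hi⟩
  refine not_countable_complex ((Set.countable_iUnion fun i => ?_).mono this)
  exact (Polynomial.finite_setOfPred_isRoot (hq i)).countable

section
variable {r : ℕ}

/-- Weights `d` of the nodes `j = 1, …, r` of `D_r` with `d_0 = 0` and `C d > 0` for the Cartan matrix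
`C`: twice the coefficients of the sum of the positive coroots. -/
def nodeWeight (r j : ℕ) : ℕ := if j ≤ r - 2 then 2 * (j * (2 * r - 1 - j)) else r * (r - 1)

lemma natDegree_extendNodes {w : Fin r → Polynomial ℂ} {c : ℕ}
    (hd : ∀ a, (w a).natDegree = c * nodeWeight r (a.val + 1)) {j : ℕ} (hj : j ≤ r) :
    (extendNodes w j).natDegree = c * nodeWeight r j := by
  cases j with
  | zero => simp [extendNodes_zero, nodeWeight]
  | succ k => exact (congrArg _ (extendNodes_succ w ⟨k, hj⟩)).trans (hd ⟨k, hj⟩)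

lemma monic_extendNodes {w : Fin r → Polynomial ℂ} (hw : ∀ a, (w a).Monic) (j : ℕ) :
    (extendNodes w j).Monic := by
  unfold extendNodes
  split_ifs
  · exact hw _
  · exact Polynomial.monic_one

lemma natDegree_neighborProd_lt (hr : 3 ≤ r) {w : Fin r → Polynomial ℂ} {c : ℕ} (hc : 0 < c)
    (hw : ∀ a, (w a).Monic) (hd : ∀ a, (w a).natDegree = c * nodeWeight r (a.val + 1))
    (a : Fin r) : (neighborProd w a).natDegree < 2 * (c * nodeWeight r (a.val + 1)) := by
  have hm := monic_extendNodes hw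
  have hn := fun j => natDegree_extendNodes hd (j := j)
  obtain ⟨a, ha⟩ := a
  obtain ⟨s, rfl⟩ : ∃ s, r = s + 3 := ⟨r - 3, by omega⟩
  by_cases h1 : a + 3 < s + 3
  · rw [neighborProd_chain w h1, (hm _).natDegree_mul (hm _), hn _ (by simp; omega),
      hn _ (by simp; omega), ← mul_add, mul_left_comm]
    refine Nat.mul_lt_mul_of_pos_left ?_ hc
    obtain ⟨t, rfl⟩ : ∃ t, s = a + 1 + t := ⟨s - a - 1, by omega⟩
    unfold nodeWeight
    simp only
    rw [if_pos (by omega), if_pos (by omega), if_pos (by omega),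
      show 2 * (a + 1 + t + 3) - 1 - a = a + 2 * t + 7 by omega,
      show 2 * (a + 1 + t + 3) - 1 - (a + 2) = a + 2 * t + 5 by omega,
      show 2 * (a + 1 + t + 3) - 1 - (a + 1) = a + 2 * t + 6 by omega]
    nlinarith
  by_cases h2 : a + 3 = s + 3
  · obtain rfl : a = s := by omega
    rw [neighborProd_branch hr w h2, (hm _).natDegree_mul ((hm _).mul (hm _)),
      (hm _).natDegree_mul (hm _), hn _ (by simp), hn _ (by simp), hn _ le_rfl,
      ← mul_add, ← mul_add, mul_left_comm]
    refine Nat.mul_lt_mul_of_pos_left ?_ hc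
    unfold nodeWeight
    simp only
    rw [if_pos (by omega), if_neg (by omega), if_neg (by omega), if_pos (by omega),
      show 2 * (a + 3) - 1 - a = a + 5 by omega, show 2 * (a + 3) - 1 - (a + 1) = a + 4 by omega,
      show a + 3 - 1 = a + 2 by omega]
    nlinarith
  · rw [neighborProd_spin hr w (by simp; omega), hn _ (by omega), mul_left_comm]
    refine Nat.mul_lt_mul_of_pos_left ?_ hc
    unfold nodeWeight
    simp only
    rw [if_pos (by omega), if_neg (by omega), show s + 3 - 2 = s + 1 by omega,
      show 2 * (s + 3) - 1 - (s + 1) = s + 4 by omega, show s + 3 - 1 = s + 2 by omega]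
    nlinarith

/-- Along the curve `x_j = t ^ d_j` the component `z_{am}` is a monic polynomial of degree `m d_a`:
in `z_{a,m+1}² - ∏ z_{b,m+1} = z_{am} z_{a,m+2}` the square dominates. -/
lemma monic_dPolynomial_curve (hr : 3 ≤ r) (m : ℕ) : ∀ a : Fin r,
    (MvPolynomial.aeval (fun j : Fin r => (Polynomial.X : Polynomial ℂ) ^ nodeWeight r (j.val + 1))
      (dPolynomial a m)).Monic ∧
    (MvPolynomial.aeval (fun j : Fin r => (Polynomial.X : Polynomial ℂ) ^ nodeWeight r (j.val + 1))
      (dPolynomial a m)).natDegree = m * nodeWeight r (a.val + 1) := by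
  set v := fun j : Fin r => (Polynomial.X : Polynomial ℂ) ^ nodeWeight r (j.val + 1) with hv
  induction m using Nat.twoStepInduction with
  | zero =>
    intro a
    have : MvPolynomial.aeval v (dPolynomial a 0) = 1 := Polynomial.funext fun t => by
      rw [eval_aeval_dPolynomial, dSolution_zero, Polynomial.eval_one]
    rw [this]
    simp
  | one =>
    intro a
    have : MvPolynomial.aeval v (dPolynomial a 1) = v a := Polynomial.funext fun t => by
      rw [eval_aeval_dPolynomial, dSolution_one _ hr]
    rw [this]
    simp [hv, Polynomial.monic_X_pow]
  | more m ih0 ih1 =>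
    intro a
    have hrec : neighborProd (fun a' => MvPolynomial.aeval v (dPolynomial a' (m + 1))) a +
        MvPolynomial.aeval v (dPolynomial a m) * MvPolynomial.aeval v (dPolynomial a (m + 2)) =
        MvPolynomial.aeval v (dPolynomial a (m + 1)) ^ 2 := Polynomial.funext fun t => by
      have := dSolution_recursion hr (fun j => (v j).eval t) m a
      simp only [neighborProd, Polynomial.eval_add, Polynomial.eval_mul, Polynomial.eval_pow,
        Polynomial.eval_prod, eval_aeval_dPolynomial] at this ⊢
      exact this
    have hlt := natDegree_neighborProd_lt hr (Nat.succ_pos m) (fun a => (ih1 a).1)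
      (fun a => (ih1 a).2) a
    have hsq := (ih1 a).1.pow 2
    have hsqd : (MvPolynomial.aeval v (dPolynomial a (m + 1)) ^ 2).natDegree =
        2 * ((m + 1) * nodeWeight r (a.val + 1)) := by
      rw [(ih1 a).1.natDegree_pow, (ih1 a).2]
    have hdeg : (neighborProd (fun a' => MvPolynomial.aeval v (dPolynomial a' (m + 1))) a).degree <
        (MvPolynomial.aeval v (dPolynomial a (m + 1)) ^ 2).degree :=
      Polynomial.degree_lt_degree (hlt.trans_eq hsqd.symm)
    rw [eq_comm, ← sub_eq_iff_eq_add'] at hrec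
    have hmon := hsq.sub_of_left hdeg
    have hnd := Polynomial.natDegree_eq_of_degree_eq (Polynomial.degree_sub_eq_left_of_degree_lt hdeg)
    rw [hrec] at hmon hnd
    have h2 := (ih0 a).1.of_mul_monic_left hmon
    refine ⟨h2, ?_⟩
    rw [(ih0 a).1.natDegree_mul h2, hsqd, (ih0 a).2] at hnd
    linarith

theorem exists_dSolution_ne_zero (hr : 3 ≤ r) : ∃ x : Fin r → ℂ, ∀ a m, dSolution x a m ≠ 0 := by
  obtain ⟨t, ht⟩ := exists_forall_eval_ne_zero (ι := Fin r × ℕ)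
    (fun p => (monic_dPolynomial_curve hr p.2 p.1).1.ne_zero)
  exact ⟨_, fun a m h => ht (a, m) ((eval_aeval_dPolynomial _ a m t).trans h)⟩

end

/-! ### The variety -/

section
variable {r : ℕ}

lemma finprod_cartanAInf (v : ℕ → ℂ) (k : ℕ) :
    ∏ᶠ k', v k' ^ ((2 - cartanAInf) k k').toNat = (if k = 0 then 1 else v (k - 1)) * v (k + 1) := by
  have h : ∀ k', ((2 - cartanAInf) k k').toNat = if k + 1 = k' ∨ k' + 1 = k then 1 else 0 := by
    intro k'
    simp only [Matrix.sub_apply, cartanAInf, of_apply, Matrix.ofNat_apply]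
    split_ifs <;> omega
  simp only [h]
  rw [finprod_eq_prod_of_mulSupport_subset (s := if k = 0 then {k + 1} else {k - 1, k + 1})]
  · split_ifs with h0
    · simp
    · rw [Finset.prod_pair (by omega), if_pos (by omega), if_pos (by omega), pow_one, pow_one]
  · intro k' hk'
    simp only [Function.mem_mulSupport] at hk'
    by_cases hc : k + 1 = k' ∨ k' + 1 = k
    · split_ifs <;> simp <;> omega
    · rw [if_neg hc, pow_zero] at hk'
      exact absurd rfl hk'

lemma finprod_cartanA {n : ℕ} (v : Fin n → ℂ) {k : ℕ} (hk : k + 1 < n) :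
    ∏ᶠ k', v k' ^ ((2 - CartanMatrix.A n) ⟨k, by omega⟩ k').toNat =
      (if k = 0 then 1 else v ⟨k - 1, by omega⟩) * v ⟨k + 1, hk⟩ := by
  have h : ∀ k', ((2 - CartanMatrix.A n) ⟨k, by omega⟩ k').toNat =
      if k + 1 = k'.val ∨ k'.val + 1 = k then 1 else 0 := by
    intro k'
    simp only [Matrix.sub_apply, CartanMatrix.A, of_apply, Matrix.ofNat_apply, Fin.ext_iff]
    split_ifs <;> omega
  simp only [h]
  rw [finprod_eq_prod_of_mulSupport_subset
    (s := if k = 0 then {⟨k + 1, hk⟩} else {⟨k - 1, by omega⟩, ⟨k + 1, hk⟩})]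
  · split_ifs with h0
    · simp
    · rw [Finset.prod_pair (by simp), if_pos (by simp; omega), if_pos (by simp), pow_one, pow_one]
  · intro k' hk'
    simp only [Function.mem_mulSupport] at hk'
    by_cases hc : k + 1 = k'.val ∨ k'.val + 1 = k
    · split_ifs <;> simp [Fin.ext_iff] <;> omega
    · rw [if_neg hc, pow_zero] at hk'
      exact absurd rfl hk'

theorem dSolution_mem_hirotaSolutions (hr : 3 ≤ r) (x : Fin r → ℂ) :
    (fun p : Fin r × ℕ => dSolution x p.1 (p.2 + 1)) ∈
      hirotaSolutions (CartanMatrix.D r) cartanAInf := by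
  intro a k
  have h := dSolution_recursion hr x k a
  rw [finprod_eq_prod_of_fintype, finprod_cartanAInf (fun k' => dSolution x a (k' + 1)), ← h]
  congr 2
  split_ifs with h0
  · rw [h0, dSolution_zero]
  · rw [Nat.sub_add_cancel (by omega)]

/-- A solution of the recursion without zeros is determined by its values at `m = 1`, because the
value at `m + 2` is found by dividing by the one at `m`. -/
theorem eq_dSolution_of_recursion (hr : 3 ≤ r) {N : ℕ} {w : ℕ → Fin r → ℂ} (h0 : ∀ a, w 0 a = 1)
    (hne : ∀ m a, w m a ≠ 0)
    (hrec : ∀ m, m + 2 ≤ N → ∀ a,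
      neighborProd (w (m + 1)) a + w m a * w (m + 2) a = w (m + 1) a ^ 2) (m : ℕ) :
    m ≤ N → ∀ a, w m a = dSolution (w 1) a m := by
  induction m using Nat.twoStepInduction with
  | zero => intro _ a; rw [h0, dSolution_zero]
  | one => intro _ a; rw [dSolution_one _ hr]
  | more m ih0 ih1 =>
    intro hm a
    have h1 := hrec m hm a
    have h2 := dSolution_recursion hr (w 1) m a
    rw [← ih0 (by omega), ← ih1 (by omega), ← funext (ih1 (by omega)), ← h1] at h2
    exact (mul_left_cancel₀ (hne m a) (add_left_cancel h2)).symm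

theorem dSolution_mem_hirotaVariety (hr : 3 ≤ r) (x : Fin r → ℂ) :
    (fun p : Fin r × ℕ => dSolution x p.1 (p.2 + 1)) ∈
      hirotaVariety (CartanMatrix.D r) cartanAInf := by
  intro p hp
  obtain ⟨y, hy⟩ := exists_dSolution_ne_zero hr
  let v : Fin r → Polynomial ℂ := fun j =>
    Polynomial.C (x j) + Polynomial.X * Polynomial.C (y j - x j)
  let g : Polynomial ℂ := MvPolynomial.aeval
    (fun q : Fin r × ℕ => MvPolynomial.aeval v (dPolynomial q.1 (q.2 + 1))) p
  have hg : ∀ t, g.eval t = MvPolynomial.aeval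
      (fun q : Fin r × ℕ => dSolution (fun j => (v j).eval t) q.1 (q.2 + 1)) p := by
    intro t
    rw [← Polynomial.coe_aeval_eq_eval, ← AlgHom.comp_apply, MvPolynomial.comp_aeval]
    congr 2
    ext q
    rw [Polynomial.coe_aeval_eq_eval, eval_aeval_dPolynomial]
  have hv1 : (fun j => (v j).eval 1) = y := by ext j; simp [v]
  have hv0 : (fun j => (v j).eval 0) = x := by ext j; simp [v]
  -- a nonzero `g` would be nonzero at some parameter where no component vanishes either
  have hg0 : g = 0 := by
    by_contra hne
    obtain ⟨t, ht⟩ := exists_forall_eval_ne_zero (ι := Option (Fin r × ℕ))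
      (q := fun o => o.elim g fun q => MvPolynomial.aeval v (dPolynomial q.1 (q.2 + 1))) (by
        rintro (_ | q)
        · exact hne
        · intro h
          have := eval_aeval_dPolynomial v q.1 (q.2 + 1) 1
          simp only [Option.elim_some] at h
          rw [h, hv1, Polynomial.eval_zero] at this
          exact hy _ _ this.symm)
    refine ht none ((hg t).trans (hp _ ⟨dSolution_mem_hirotaSolutions hr _, fun q => ?_⟩))
    have := ht (some q)
    simp only [Option.elim_some] at this
    rwa [eval_aeval_dPolynomial] at this
  have := hg 0
  rw [hg0, hv0, Polynomial.eval_zero] at this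
  exact this.symm

/-- The formulas are polynomial, so they extend from the solutions without zeros to the Zariski
closure. -/
lemma eq_dSolution_of_mem_hirotaVariety {ι : Type} [DecidableEq ι] {CY : Matrix ι ι ℤ} {k₀ k : ι}
    {a : Fin r} {m : ℕ}
    (h : ∀ z ∈ hirotaSolutions (CartanMatrix.D r) CY, (∀ p, z p ≠ 0) →
      z (a, k) = dSolution (fun j => z (j, k₀)) a m)
    {z : Fin r × ι → ℂ} (hz : z ∈ hirotaVariety (CartanMatrix.D r) CY) :
    z (a, k) = dSolution (fun j => z (j, k₀)) a m := by
  have hev : ∀ z : Fin r × ι → ℂ, MvPolynomial.aeval z (MvPolynomial.X (R := ℂ) (a, k) -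
      MvPolynomial.rename (fun j => (j, k₀)) (dPolynomial a m)) =
      z (a, k) - dSolution (fun j => z (j, k₀)) a m := by
    intro z
    rw [map_sub, MvPolynomial.aeval_X, MvPolynomial.aeval_rename, ← aeval_dPolynomial]
    rfl
  rw [← sub_eq_zero, ← hev]
  refine hz _ fun z' hz' => ?_
  rw [hev, sub_eq_zero]
  exact h z' hz'.1 hz'.2

lemma eq_dSolution_of_mem_AInf (hr : 3 ≤ r) {z : Fin r × ℕ → ℂ}
    (hz : z ∈ hirotaSolutions (CartanMatrix.D r) cartanAInf) (hne : ∀ p, z p ≠ 0) (a : Fin r)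
    (k : ℕ) : z (a, k) = dSolution (fun j => z (j, 0)) a (k + 1) := by
  refine eq_dSolution_of_recursion hr (N := k + 1)
    (w := fun m a => if m = 0 then 1 else z (a, m - 1)) (by simp) ?_ ?_ (k + 1) le_rfl a
  · intro m a
    split_ifs
    · exact one_ne_zero
    · exact hne _
  · intro m _ a
    have h := hz a m
    rw [finprod_eq_prod_of_fintype, finprod_cartanAInf (fun k' => z (a, k'))] at h
    exact h

lemma eq_dSolution_of_mem_A (hr : 3 ≤ r) {n : ℕ} (hn : 0 < n) {z : Fin r × Fin n → ℂ}
    (hz : z ∈ hirotaSolutions (CartanMatrix.D r) (CartanMatrix.A n)) (hne : ∀ p, z p ≠ 0)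
    (a : Fin r) (k : Fin n) : z (a, k) = dSolution (fun j => z (j, ⟨0, hn⟩)) a (k.val + 1) := by
  have key := eq_dSolution_of_recursion hr (N := n)
    (w := fun m a => if h : 1 ≤ m ∧ m ≤ n then z (a, ⟨m - 1, by omega⟩) else 1) (by simp) ?_ ?_
    (k.val + 1) (by omega) a
  · simpa [hn, Nat.succ_le_iff] using key
  · intro m a
    split_ifs
    · exact hne _
    · exact one_ne_zero
  · intro m hm a
    have h := hz a ⟨m, by omega⟩
    rw [finprod_eq_prod_of_fintype, finprod_cartanA (fun k' => z (a, k')) (by omega)] at h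
    have h1 : 1 ≤ m + 1 ∧ m + 1 ≤ n := by omega
    have h2 : 1 ≤ m + 2 ∧ m + 2 ≤ n := by omega
    simp only [dif_pos h1, dif_pos h2]
    have h0 : (if h : 1 ≤ m ∧ m ≤ n then z (a, ⟨m - 1, by omega⟩) else 1) =
        if m = 0 then 1 else z (a, ⟨m - 1, by omega⟩) := by
      split_ifs <;> first | rfl | omega
    rw [h0]
    exact h

end

end

theorem theorem10 (r : ℕ) (hr : 3 ≤ r) :
    -- the matrices of the two spinor nodes are antisymmetric
    (∀ (x : Fin r → ℂ) (m : ℕ), 1 ≤ m →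
      (dTMinus x m)ᵀ = -dTMinus x m ∧ (dTPlus x m)ᵀ = -dTPlus x m) ∧
    -- every `x` gives a solution for `(D_r, A_ℕ)` with `z_{i1} = x_i`, and a point of the variety
    (∀ x : Fin r → ℂ,
      (fun p : Fin r × ℕ => dSolution x p.1 (p.2 + 1)) ∈
        hirotaSolutions (CartanMatrix.D r) cartanAInf ∧
      (fun p : Fin r × ℕ => dSolution x p.1 (p.2 + 1)) ∈
        hirotaVariety (CartanMatrix.D r) cartanAInf ∧
      ∀ a : Fin r, dSolution x a 1 = x a) ∧
    -- the formulas hold in `S(D_r, A_ℕ)`, with `x_i = z_{i1}`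
    (∀ z ∈ hirotaVariety (CartanMatrix.D r) cartanAInf, ∀ (a : Fin r) (k : ℕ),
      z (a, k) = dSolution (fun j => z (j, 0)) a (k + 1)) ∧
    -- the formulas hold in `S(D_r, A_n)`, with `x_i = z_{i1}`
    (∀ (n : ℕ) (hn : 0 < n), ∀ z ∈ hirotaVariety (CartanMatrix.D r) (CartanMatrix.A n),
      ∀ (a : Fin r) (k : Fin n),
        z (a, k) = dSolution (fun j => z (j, ⟨0, hn⟩)) a (k.val + 1)) := by
  refine ⟨fun x m _ => ⟨?_, ?_⟩, fun x => ⟨dSolution_mem_hirotaSolutions hr x,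
    dSolution_mem_hirotaVariety hr x, dSolution_one x hr⟩, fun z hz a k =>
      eq_dSolution_of_mem_hirotaVariety (fun z hz hne => eq_dSolution_of_mem_AInf hr hz hne a k) hz,
    fun n hn z hz a k =>
      eq_dSolution_of_mem_hirotaVariety (fun z hz hne => eq_dSolution_of_mem_A hr hn hz hne a k) hz⟩
  · rw [dTMinus_eq]
    ext i j
    exact spinArray_alternating x _ _
  · rw [dTPlus_eq]
    ext i j
    exact spinArray_alternating x _ _
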